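/- Let $d, N \ge 1$ be integers. All functions are real-valued, and functions on $\mathbb{R}^d$ are identified when they agree almost everywhere. Let $Y^d = L^p(\mathbb{R}^d) + L^\infty(\mathbb{R}^d)$ with $p = 1$ if $d = 1$, some $p > 1$ if $d = 2$, and $p = d/2$ if $d \ge 3$. Let $\mathcal{P}_N$ be the set of $N$-tuples $\Phi = (\phi_1, \dots, \phi_N)$ of functions in $H^1(\mathbb{R}^d)$ that are orthonormal in $L^2(\mathbb{R}^d)$, and let $W_N$ be the set of potentials $v \in Y^d$ for which the functional $$\Phi \mapsto \sum_{i=1}^N \int_{\mathbb{R}^d} \left( \|\nabla \phi_i\|^2 + 2 \phi_i^2 v \right)$$ attains its minimum over $\mathcal{P}_N$. For $v \in W_N$, a system of restricted Kohn–Sham orbitals of $v$ is a minimizer $(\psi_1, \dots, \psi_N) \in \mathcal{P}_N$ of this functional for which there are real numbers $\lambda_1, \dots, \lambda_N$ (the eigenvalues) such that, for every $1 \le j \le N$ and every $w \in H^1(\mathbb{R}^d)$, $$\frac12 \int_{\mathbb{R}^d} \nabla \psi_j \cdot \nabla w + \int_{\mathbb{R}^d} v \psi_j w = \lambda_j \int_{\mathbb{R}^d}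 \psi_j w .$$ A lowest-eigenvalue orbital of $v$ is a member $\psi_j$ of such a system with $\lambda_j = \min_{1 \le i \le N} \lambda_i$. Let $v \in W_N$ and $$\mathcal{E}(f) = \frac12 \int_{\mathbb{R}^d} \|\nabla f\|^2 + \int_{\mathbb{R}^d} v f^2 .$$ Then: 1. There is a lowest-eigenvalue orbital of $v$, and every lowest-eigenvalue orbital of $v$ minimizes $\mathcal{E}$ over all $f \in H^1(\mathbb{R}^d)$ with $\|f\|_{L^2(\mathbb{R}^d)} = 1$. 2. If $f$ is any minimizer of $\mathcal{E}$ under this constraint, then $|f|$ is also a minimizer, and $|f|$ is a lowest-eigenvalue orbital of $v$. 3. If in addition $v \in L^\infty(\mathbb{R}^d)$, then the lowest-eigenvalue orbital of $v$ is unique up to a change of sign (any two agree up to sign, almost everywhere), and it can be chosen to be strictly positive. -/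

import Mathlib

open MeasureTheory
open scoped ContDiff ENNReal

noncomputable section

namespace RKS

/-- The Euclidean space `ℝᵈ`. -/
abbrev Space (d : ℕ) : Type := EuclideanSpace ℝ (Fin d)

/-- `g` is a weak gradient of `f` on `ℝᵈ`: both are locally integrable and
`∫ f ∂_y φ = - ∫ ⟨g, y⟩ φ` for all test functions `φ ∈ C_c^∞(ℝᵈ)` and all directions `y`. -/
def HasWeakGradient {d : ℕ} (f : Space d → ℝ) (g : Space d → Space d) : Prop :=
  LocallyIntegrable f volume ∧ LocallyIntegrable g volume ∧
    ∀ φ : Space d → ℝ, ContDiff ℝ ∞ φ → HasCompactSupport φ → ∀ y : Space d,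
      ∫ x, f x * fderiv ℝ φ x y = -∫ x, inner ℝ (g x) y * φ x

open Classical in
/-- The weak gradient `∇f` (a representative; it is unique up to null sets, see
`weakGradient_ae_eq`). It has the value `0` if `f` has no weak gradient. -/
def weakGradient {d : ℕ} (f : Space d → ℝ) : Space d → Space d :=
  if h : ∃ g, HasWeakGradient f g then h.choose else 0

/-- Weak gradients are unique almost everywhere. -/
theorem HasWeakGradient.ae_eq {d : ℕ} {f : Space d → ℝ} {g h : Space d → Space d}
    (hg : HasWeakGradient f g) (hh : HasWeakGradient f h) : g =ᵐ[volume] h := by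
  have key : ∀ i : Fin d, ∀ᵐ x, g x i - h x i = 0 := by
    intro i
    have pr : ∀ k : Space d → Space d, LocallyIntegrable k volume →
        LocallyIntegrable (fun x => k x i) volume := by
      intro k hk
      rw [locallyIntegrable_iff] at hk ⊢
      intro K hK
      let P : Space d →L[ℝ] ℝ := EuclideanSpace.proj i
      exact P.integrable_comp (hk K hK)
    have lg := pr g hg.2.1
    have lh := pr h hh.2.1
    have mi : ∀ k : Space d → ℝ, LocallyIntegrable k volume → ∀ φ : Space d → ℝ,
        ContDiff ℝ ∞ φ → HasCompactSupport φ → Integrable (fun x => φ x * k x) volume := by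
      intro k hk φ hφ hc
      simpa [smul_eq_mul] using
        hk.integrable_smul_left_of_hasCompactSupport hφ.continuous hc
    refine ae_eq_zero_of_integral_contDiff_smul_eq_zero (lg.sub lh) ?_
    intro φ hφ hc
    have e1 := hg.2.2 φ hφ hc (EuclideanSpace.single i 1)
    have e2 := hh.2.2 φ hφ hc (EuclideanSpace.single i 1)
    rw [e1] at e2
    simp only [EuclideanSpace.inner_single_right, one_mul, conj_trivial, neg_inj] at e2
    have : ∫ x, (φ x * g x i - φ x * h x i) = 0 := by
      rw [integral_sub (mi _ lg φ hφ hc) (mi _ lh φ hφ hc)]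
      simp only [mul_comm (φ _)]
      linarith
    simpa [smul_eq_mul, mul_sub] using this
  have := ae_all_iff.2 key
  filter_upwards [this] with x hx
  ext i
  linarith [hx i]

/-- The chosen weak gradient agrees almost everywhere with any weak gradient. -/
theorem weakGradient_ae_eq {d : ℕ} {f : Space d → ℝ} {g : Space d → Space d}
    (hg : HasWeakGradient f g) : weakGradient f =ᵐ[volume] g := by
  have h : ∃ g, HasWeakGradient f g := ⟨g, hg⟩
  have e : weakGradient f = h.choose := dif_pos h
  rw [e]
  exact h.choose_spec.ae_eq hg

/-- Membership in the real Sobolev space `H¹(ℝᵈ)`. -/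
def MemH1 {d : ℕ} (f : Space d → ℝ) : Prop :=
  MemLp f 2 volume ∧ ∃ g : Space d → Space d, MemLp g 2 volume ∧ HasWeakGradient f g

/-- The exponents `p` admitted in dimension `d`:
`p = 1` if `d = 1`, `p > 1` if `d = 2`, and `p = d / 2` if `d ≥ 3`. -/
def AdmissibleExponent (d : ℕ) (p : ℝ≥0∞) : Prop :=
  (d = 1 ∧ p = 1) ∨ (d = 2 ∧ 1 < p) ∨ (3 ≤ d ∧ p = (d : ℝ≥0∞) / 2)

/-- Membership in the space of potentials `Yᵈ = Lᵖ(ℝᵈ) + L^∞(ℝᵈ)`. -/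
def MemY {d : ℕ} (v : Space d → ℝ) : Prop :=
  ∃ p : ℝ≥0∞, AdmissibleExponent d p ∧ ∃ v₁ v₂ : Space d → ℝ,
    MemLp v₁ p volume ∧ MemLp v₂ ∞ volume ∧ v = v₁ + v₂

/-- `𝒫_N`: the `N`-tuples of `H¹` functions that are orthonormal in `L²(ℝᵈ)`. -/
def OrthonormalOrbitals (d N : ℕ) : Set (Fin N → Space d → ℝ) :=
  {Φ | (∀ i, MemH1 (Φ i)) ∧ ∀ i j, ∫ x, Φ i x * Φ j x = if i = j then 1 else 0}

/-- The functional `Φ ↦ ∑ᵢ ∫ (‖∇φᵢ‖² + 2 φᵢ² v)`. -/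
def orbitalEnergy {d N : ℕ} (v : Space d → ℝ) (Φ : Fin N → Space d → ℝ) : ℝ :=
  ∑ i, ∫ x, (‖weakGradient (Φ i) x‖ ^ 2 + 2 * Φ i x ^ 2 * v x)

/-- `Φ` minimizes the orbital energy over `𝒫_N`. -/
def IsOrbitalMinimizer {d N : ℕ} (v : Space d → ℝ) (Φ : Fin N → Space d → ℝ) : Prop :=
  Φ ∈ OrthonormalOrbitals d N ∧ ∀ Ψ ∈ OrthonormalOrbitals d N, orbitalEnergy v Φ ≤ orbitalEnergy v Ψ

/-- `W_N`: the potentials in `Yᵈ` for which the orbital energy attains its infimum over `𝒫_N`. -/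
def W (d N : ℕ) : Set (Space d → ℝ) :=
  {v | MemY v ∧ ∃ Φ : Fin N → Space d → ℝ, IsOrbitalMinimizer v Φ}

/-- `ψ` satisfies `-½ Δψ + v ψ = μ ψ` weakly, tested against all of `H¹(ℝᵈ)`. -/
def IsWeakEigenfunction {d : ℕ} (v : Space d → ℝ) (ψ : Space d → ℝ) (μ : ℝ) : Prop :=
  ∀ w : Space d → ℝ, MemH1 w →
    (1 / 2) * (∫ x, inner ℝ (weakGradient ψ x) (weakGradient w x)) + (∫ x, v x * ψ x * w x)
      = μ * (∫ x, ψ x * w x)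

/-- `ψ` is a system of restricted Kohn-Sham orbitals of `v` with eigenvalues `μ`: a minimizer of
the orbital energy over `𝒫_N` that diagonalizes the Euler-Lagrange equations. -/
def IsRKSOrbitals {d N : ℕ} (v : Space d → ℝ) (ψ : Fin N → Space d → ℝ) (μ : Fin N → ℝ) : Prop :=
  IsOrbitalMinimizer v ψ ∧ ∀ j, IsWeakEigenfunction v (ψ j) (μ j)

/-- `f` is a lowest eigenvalue orbital of `v`: a member of a system of `N` restricted Kohn-Sham
orbitals whose eigenvalue is the smallest of the `N` eigenvalues of that system. -/
def IsLowestOrbital {d : ℕ} (N : ℕ) (v : Space d → ℝ) (f : Space d → ℝ) : Prop :=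
  ∃ (ψ : Fin N → Space d → ℝ) (μ : Fin N → ℝ), IsRKSOrbitals v ψ μ ∧
    ∃ j, (∀ i, μ j ≤ μ i) ∧ f = ψ j

/-- The energy `ℰ(f) = ½ ∫ ‖∇f‖² + ∫ v f²`. -/
def energy {d : ℕ} (v : Space d → ℝ) (f : Space d → ℝ) : ℝ :=
  (1 / 2) * (∫ x, ‖weakGradient f x‖ ^ 2) + (∫ x, v x * f x ^ 2)

/-- `f` minimizes `ℰ` over the `H¹` functions with `‖f‖_{L²} = 1`. -/
def IsEnergyMinimizer {d : ℕ} (v : Space d → ℝ) (f : Space d → ℝ) : Prop :=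
  (MemH1 f ∧ ∫ x, f x ^ 2 = 1) ∧
    ∀ g : Space d → ℝ, MemH1 g → ∫ x, g x ^ 2 = 1 → energy v f ≤ energy v g

end RKS

end

noncomputable section

open Filter Topology Metric
open scoped Convolution

namespace RKS

/-! Half of the orbital functional is the trace of the quadratic form `a(f, g) = ½ ∫ ∇f · ∇g + ∫ v f
g` over families orthonormal for the `L²` form `b`. Both forms are defined on all of `H¹`, because
the Sobolev embedding makes `v f²` integrable. The first two claims are then linear algebra.
Perturbing one member of a trace minimizer orthogonally to the whole family gives its first and
second order conditions; rotating the family diagonalizes `a` on its span. Hence the smallest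
eigenvalue `λ` is the bottom of `a` relative to `b` (`IsTraceMinimizer.lowest_mul_le`). Conversely,
any normalized eigenvector for `λ` is brought into the system by a reflection that commutes with the
Hamiltonian (`IsTraceMinimizer.exists_apply_eq`). Since `|∇|f|| ≤ |∇f|`, passing to `|f|` does not
raise the energy, so `|f|` attains the bottom too, and a vector attaining the bottom of a form is an
eigenvector.

Uniqueness for bounded `v` rests on a strong maximum principle (`ae_eq_zero_or_ae_pos`) proved
without Harnack's inequality. Testing the equation of an eigenfunction `u ≥ 0` with a regularization
of `φ² / u` shows that `|∇u| / u` is locally square integrable. This dominates the gradients of `u /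
√(u² + ε²)`, which tend to zero, so `sign u` has zero weak gradient and is constant. Applied to `|f|
- f` and to `|f|`, this gives every ground state a strict sign. The difference of two positive
normalized ground states solves the same equation, so it has a strict sign or vanishes, and equality
of the norms leaves only the latter. -/

/-! ### Convergence and convolution in `L²` -/

theorem eLpNorm_two_sq {α E : Type*} [MeasurableSpace α] [NormedAddCommGroup E] (μ : Measure α)
    (f : α → E) : eLpNorm f 2 μ ^ 2 = ∫⁻ x, ‖f x‖ₑ ^ 2 ∂μ := by
  have := eLpNorm_nnreal_pow_eq_lintegral (f := f) (μ := μ) (p := 2) two_ne_zero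
  simpa using this

/-- Almost everywhere convergence without gain of norm implies convergence in `L²`. -/
theorem tendsto_eLpNorm_two_sub_of_ae_tendsto {α E : Type*} [MeasurableSpace α] {μ : Measure α}
    [NormedAddCommGroup E] {f : ℕ → α → E} {g : α → E} (hf : ∀ n, AEStronglyMeasurable (f n) μ)
    (hg : MemLp g 2 μ) (hle : ∀ n, eLpNorm (f n) 2 μ ≤ eLpNorm g 2 μ)
    (hlim : ∀ᵐ x ∂μ, Tendsto (fun n => f n x) atTop (𝓝 (g x))) :
    Tendsto (fun n => eLpNorm (f n - g) 2 μ) atTop (𝓝 0) := by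
  set A : ℝ≥0∞ := ∫⁻ x, ‖g x‖ₑ ^ 2 ∂μ with hA
  have hAg : A = eLpNorm g 2 μ ^ 2 := (eLpNorm_two_sq μ g).symm
  have hAtop : A ≠ ⊤ := by
    rw [hAg]; exact ENNReal.pow_ne_top hg.eLpNorm_ne_top
  have hfA : ∀ n, ∫⁻ x, ‖f n x‖ₑ ^ 2 ∂μ ≤ A := fun n => by
    rw [hAg, ← eLpNorm_two_sq]; gcongr; exact hle n
  have par : ∀ a b : E, 0 ≤ 2 * ‖a‖ ^ 2 + 2 * ‖b‖ ^ 2 - ‖a - b‖ ^ 2 := fun a b => by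
    have h1 := norm_sub_le a b
    nlinarith [norm_nonneg (a - b), sq_nonneg (‖a‖ - ‖b‖)]
  -- Fatou's lemma is applied to this parallelogram defect, which is nonnegative and tends to `4
  -- ‖g‖²`. The norm bound gives `∫ h n + ‖f n - g‖² ≤ 4 A`, so in the limit nothing is left for the
  -- second term.
  let h : ℕ → α → ℝ≥0∞ := fun n x =>
    ENNReal.ofReal (2 * ‖f n x‖ ^ 2 + 2 * ‖g x‖ ^ 2 - ‖f n x - g x‖ ^ 2)
  have hm : ∀ n, AEMeasurable (h n) μ := fun n =>
    (((((hf n).norm.aemeasurable.pow_const 2).const_mul 2).add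
      ((hg.1.norm.aemeasurable.pow_const 2).const_mul 2)).sub
      (((hf n).sub hg.1).norm.aemeasurable.pow_const 2)).ennreal_ofReal
  have hsq : ∀ a : E, ‖a‖ₑ ^ 2 = ENNReal.ofReal (‖a‖ ^ 2) := fun a => by
    rw [← ofReal_norm, ENNReal.ofReal_pow (norm_nonneg _)]
  have hsum : ∀ n, ∫⁻ x, h n x ∂μ + eLpNorm (f n - g) 2 μ ^ 2 ≤ 4 * A := fun n => by
    rw [eLpNorm_two_sq, ← lintegral_add_left' (hm n)]
    calc ∫⁻ x, h n x + ‖(f n - g) x‖ₑ ^ 2 ∂μ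
        = ∫⁻ x, 2 * ‖f n x‖ₑ ^ 2 + 2 * ‖g x‖ₑ ^ 2 ∂μ := by
          refine lintegral_congr fun x => ?_
          simp only [h, hsq, Pi.sub_apply]
          rw [← ENNReal.ofReal_add (par _ _) (by positivity), sub_add_cancel,
            ENNReal.ofReal_add (by positivity) (by positivity),
            ENNReal.ofReal_mul (by norm_num), ENNReal.ofReal_mul (by norm_num)]
          simp
      _ = 2 * ∫⁻ x, ‖f n x‖ₑ ^ 2 ∂μ + 2 * A := by
          rw [lintegral_add_right' _ ((hg.1.enorm.pow_const 2).const_mul 2),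
            lintegral_const_mul'' _ ((hf n).enorm.pow_const 2),
            lintegral_const_mul'' _ (hg.1.enorm.pow_const 2)]
      _ ≤ 2 * A + 2 * A := by gcongr; exact hfA n
      _ = 4 * A := by rw [← add_mul]; norm_num
  have hfatou : 4 * A ≤ liminf (fun n => ∫⁻ x, h n x ∂μ) atTop := by
    refine le_trans (le_of_eq ?_) (lintegral_liminf_le' hm)
    rw [hA, ← lintegral_const_mul'' _ (hg.1.enorm.pow_const 2)]
    refine lintegral_congr_ae ?_
    filter_upwards [hlim] with x hx
    have : Tendsto (fun n => h n x) atTop (𝓝 (4 * ‖g x‖ₑ ^ 2)) := by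
      have e : (4 : ℝ≥0∞) * ‖g x‖ₑ ^ 2
          = ENNReal.ofReal (2 * ‖g x‖ ^ 2 + 2 * ‖g x‖ ^ 2 - ‖g x - g x‖ ^ 2) := by
        rw [hsq, sub_self, norm_zero, show 2 * ‖g x‖ ^ 2 + 2 * ‖g x‖ ^ 2 - 0 ^ 2 = 4 * ‖g x‖ ^ 2 by
          ring, ENNReal.ofReal_mul (by norm_num)]
        simp
      rw [e]
      exact ENNReal.tendsto_ofReal (((hx.norm.pow 2).const_mul 2 |>.add tendsto_const_nhds).sub
        ((hx.sub_const _).norm.pow 2))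
    exact this.liminf_eq.symm
  have hsqlim : Tendsto (fun n => eLpNorm (f n - g) 2 μ ^ 2) atTop (𝓝 0) := by
    rw [ENNReal.tendsto_nhds_zero]
    intro ε hε
    -- The strict inequality `4 A - ε < 4 A` below fails when `A = 0`.
    rcases eq_or_ne A 0 with hA0 | hA0
    · refine Eventually.of_forall fun n => ?_
      have := (le_add_self).trans (hsum n)
      rw [hA0, mul_zero] at this
      exact this.trans zero_le
    have h4 : 4 * A ≠ ⊤ := ENNReal.mul_ne_top (by norm_num) hAtop
    have hlt : 4 * A - ε < liminf (fun n => ∫⁻ x, h n x ∂μ) atTop :=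
      lt_of_lt_of_le (ENNReal.sub_lt_self h4 (by simpa using hA0) hε.ne') hfatou
    filter_upwards [eventually_lt_of_lt_liminf hlt] with n hn
    have h1 : eLpNorm (f n - g) 2 μ ^ 2 + (4 * A - ε) ≤ 4 * A := by
      rw [add_comm]; exact (add_le_add_left hn.le _).trans (hsum n)
    -- For `ε > 4 A` the subtraction truncates to zero, and the bound `4 A` is already below `ε`.
    by_cases hε4 : ε ≤ 4 * A
    · have h2 : eLpNorm (f n - g) 2 μ ^ 2 + (4 * A - ε) ≤ ε + (4 * A - ε) := by
        rwa [add_tsub_cancel_of_le hε4]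
      exact (ENNReal.add_le_add_iff_right (ne_top_of_le_ne_top h4 tsub_le_self)).1 h2
    · exact (le_add_right le_rfl).trans (h1.trans (not_le.1 hε4).le)
  have := (ENNReal.continuous_rpow_const (y := (1 / 2 : ℝ))).tendsto 0 |>.comp hsqlim
  rw [ENNReal.zero_rpow_of_pos (by norm_num)] at this
  refine this.congr fun n => ?_
  simp only [Function.comp]
  rw [← ENNReal.rpow_natCast, ← ENNReal.rpow_mul]; norm_num

/-- Convolution with a probability density does not increase the `L²` norm. -/
theorem eLpNorm_two_convolution_le {d : ℕ} {E : Type*} [NormedAddCommGroup E] [NormedSpace ℝ E]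
    {ρ : Space d → ℝ} (hρ : Continuous ρ) (hρ0 : ∀ x, 0 ≤ ρ x) (hρi : Integrable ρ)
    (hρ1 : ∫ x, ρ x = 1)
    {g : Space d → E} (hg : AEStronglyMeasurable g volume) :
    eLpNorm (ρ ⋆[ContinuousLinearMap.lsmul ℝ ℝ, volume] g) 2 volume ≤ eLpNorm g 2 volume := by
  have hone : ∫⁻ t, ‖ρ t‖ₑ = 1 := by
    have : ∫⁻ t, ‖ρ t‖ₑ = ∫⁻ t, ENNReal.ofReal (ρ t) :=
      lintegral_congr fun t => Real.enorm_of_nonneg (hρ0 t)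
    rw [this, ← ofReal_integral_eq_lintegral_ofReal hρi (Eventually.of_forall hρ0), hρ1,
      ENNReal.ofReal_one]
  have hsq : ∫⁻ x, ‖(ρ ⋆[ContinuousLinearMap.lsmul ℝ ℝ, volume] g) x‖ₑ ^ 2
      ≤ ∫⁻ x, ‖g x‖ₑ ^ 2 := by
    have hmeas : AEMeasurable (Function.uncurry fun x t : Space d => ‖ρ t‖ₑ * ‖g (x - t)‖ₑ ^ 2)
        (volume.prod volume) := by
      have h1 : AEStronglyMeasurable (fun p : Space d × Space d => g (p.1 - p.2))
          (volume.prod volume) :=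
        hg.comp_quasiMeasurePreserving (quasiMeasurePreserving_sub_of_right_invariant _ _)
      exact ((hρ.comp continuous_snd).enorm.measurable.aemeasurable).mul (h1.enorm.pow_const 2)
    have hpt : ∀ x, ‖(ρ ⋆[ContinuousLinearMap.lsmul ℝ ℝ, volume] g) x‖ₑ ^ 2
        ≤ ∫⁻ t, ‖ρ t‖ₑ * ‖g (x - t)‖ₑ ^ 2 := fun x => by
      have hgx : AEStronglyMeasurable (fun t => g (x - t)) volume :=
        hg.comp_quasiMeasurePreserving (quasiMeasurePreserving_sub_left volume x)
      have hρm : Measurable fun t => ‖ρ t‖ₑ := hρ.enorm.measurable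
      have h1 : ‖(ρ ⋆[ContinuousLinearMap.lsmul ℝ ℝ, volume] g) x‖ₑ
          ≤ ∫⁻ t, ‖ρ t‖ₑ * ‖g (x - t)‖ₑ := by
        rw [convolution_lsmul]
        refine (enorm_integral_le_lintegral_enorm _).trans (le_of_eq ?_)
        exact lintegral_congr fun t => enorm_smul _ _
      -- Cauchy–Schwarz with `ρ = ρ^(1/2) ρ^(1/2)`, that is, Jensen's inequality for the probability
      -- density `ρ`.
      have h2 := ENNReal.lintegral_mul_le_Lp_mul_Lq volume Real.HolderConjugate.two_two
        (f := fun t => ‖ρ t‖ₑ ^ (1 / 2 : ℝ)) (g := fun t => ‖ρ t‖ₑ ^ (1 / 2 : ℝ) * ‖g (x - t)‖ₑ)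
        (hρm.pow_const _).aemeasurable ((hρm.pow_const _).aemeasurable.mul hgx.enorm)
      have e1 : ∀ a : ℝ≥0∞, (a ^ (1 / 2 : ℝ)) ^ (2 : ℝ) = a := fun a => by
        rw [← ENNReal.rpow_mul]; norm_num
      have e2 : ∀ a : ℝ≥0∞, a ^ (1 / 2 : ℝ) * a ^ (1 / 2 : ℝ) = a := fun a => by
        rw [← ENNReal.rpow_add_of_nonneg _ _ (by norm_num) (by norm_num)]; norm_num
      simp only [Pi.mul_apply, ← mul_assoc, e2, ENNReal.mul_rpow_of_nonneg _ _ zero_le_two, e1,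
        hone, ENNReal.one_rpow, one_mul, ENNReal.rpow_two] at h2
      calc _ ≤ (∫⁻ t, ‖ρ t‖ₑ * ‖g (x - t)‖ₑ) ^ 2 := by gcongr
        _ ≤ ((∫⁻ t, ‖ρ t‖ₑ * ‖g (x - t)‖ₑ ^ 2) ^ (1 / 2 : ℝ)) ^ 2 := by gcongr
        _ = _ := by rw [← ENNReal.rpow_two, e1]
    calc _ ≤ ∫⁻ x, ∫⁻ t, ‖ρ t‖ₑ * ‖g (x - t)‖ₑ ^ 2 := lintegral_mono hpt
      _ = ∫⁻ t, ∫⁻ x, ‖ρ t‖ₑ * ‖g (x - t)‖ₑ ^ 2 := lintegral_lintegral_swap hmeas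
      _ = ∫⁻ t, ‖ρ t‖ₑ * ∫⁻ x, ‖g x‖ₑ ^ 2 := by
          refine lintegral_congr fun t => ?_
          rw [lintegral_const_mul' _ _ enorm_ne_top,
            lintegral_sub_right_eq_self (fun x => ‖g x‖ₑ ^ 2) t]
      _ = ∫⁻ x, ‖g x‖ₑ ^ 2 := by
          rw [lintegral_mul_const _ hρ.enorm.measurable, hone, one_mul]
  rw [← eLpNorm_two_sq, ← eLpNorm_two_sq] at hsq
  exact (ENNReal.pow_le_pow_left_iff two_ne_zero).1 hsq

/-! ### Mollification and density of test functions in `H¹` -/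

variable {d : ℕ}

theorem inner_gradient (u : Space d → ℝ) (x y : Space d) :
    inner ℝ (gradient u x) y = fderiv ℝ u x y := by
  rw [gradient, InnerProductSpace.toDual_symm_apply]

theorem norm_gradient (u : Space d → ℝ) (x : Space d) : ‖gradient u x‖ = ‖fderiv ℝ u x‖ := by
  rw [gradient, LinearIsometryEquiv.norm_map]

theorem continuous_gradient {u : Space d → ℝ} (hu : ContDiff ℝ 1 u) : Continuous (gradient u) :=
  (InnerProductSpace.toDual ℝ (Space d)).symm.continuous.comp (hu.continuous_fderiv one_ne_zero)

theorem gradient_mul {u w : Space d → ℝ} {x : Space d} (hu : DifferentiableAt ℝ u x)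
    (hw : DifferentiableAt ℝ w x) :
    gradient (fun x => u x * w x) x = u x • gradient w x + w x • gradient u x := by
  refine ext_inner_right ℝ fun y => ?_
  rw [inner_gradient, fderiv_fun_mul hu hw]
  simp [inner_add_left, inner_smul_left]

theorem hasCompactSupport_gradient {u : Space d → ℝ} (hu : HasCompactSupport u) :
    HasCompactSupport (gradient u) :=
  (hu.fderiv (𝕜 := ℝ)).comp_left (g := (InnerProductSpace.toDual ℝ (Space d)).symm) (map_zero _)

/-- The derivative falls on the kernel, and `t ↦ ρ (x - t)` is an admissible test function. The sign
from the reflection cancels the sign of the integration by parts. -/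
theorem HasWeakGradient.gradient_convolution {f : Space d → ℝ} {g : Space d → Space d}
    (h : HasWeakGradient f g) {ρ : Space d → ℝ} (hρ : ContDiff ℝ ∞ ρ) (hc : HasCompactSupport ρ)
    (x : Space d) :
    gradient (ρ ⋆[ContinuousLinearMap.lsmul ℝ ℝ, volume] f) x
      = (ρ ⋆[ContinuousLinearMap.lsmul ℝ ℝ, volume] g) x := by
  refine ext_inner_right ℝ fun y => ?_
  have hρ1 : ContDiff ℝ 1 ρ := hρ.of_le (by exact_mod_cast le_top)
  let φ : Space d → ℝ := fun t => ρ (x - t)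
  have hφ : ContDiff ℝ ∞ φ := hρ.comp (contDiff_const.sub contDiff_id)
  have hφc : HasCompactSupport φ := hc.comp_homeomorph (Homeomorph.subLeft x)
  have hφd : ∀ t, fderiv ℝ φ t y = - fderiv ℝ ρ (x - t) y := fun t => by
    have h1 : HasFDerivAt ρ (fderiv ℝ ρ (x - t)) (x - t) :=
      (hρ1.differentiable one_ne_zero _).hasFDerivAt
    have h2 : HasFDerivAt (fun t : Space d => x - t) (-ContinuousLinearMap.id ℝ (Space d)) t :=
      (hasFDerivAt_id t).const_sub x
    have h3 : HasFDerivAt φ _ t := h1.comp t h2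
    rw [h3.fderiv]
    simp
  have hd := (hc.hasFDerivAt_convolution_left (ContinuousLinearMap.lsmul ℝ ℝ) hρ1 h.1
    (μ := volume) x)
  rw [inner_gradient, hd.fderiv, convolution_eq_swap]
  have hi : Integrable fun t => (ContinuousLinearMap.precompL (Space d)
      (ContinuousLinearMap.lsmul ℝ ℝ : ℝ →L[ℝ] ℝ →L[ℝ] ℝ)) (fderiv ℝ ρ (x - t)) (f t) := by
    have := (hc.fderiv (𝕜 := ℝ)).convolutionExists_left
      (ContinuousLinearMap.precompL (Space d)
        (ContinuousLinearMap.lsmul ℝ ℝ : ℝ →L[ℝ] ℝ →L[ℝ] ℝ)) (μ := volume)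
      (hρ1.continuous_fderiv one_ne_zero) h.1 x
    exact this.integrable_swap
  rw [ContinuousLinearMap.integral_apply hi]
  have e1 : ∀ t, (ContinuousLinearMap.precompL (Space d)
      (ContinuousLinearMap.lsmul ℝ ℝ : ℝ →L[ℝ] ℝ →L[ℝ] ℝ)) (fderiv ℝ ρ (x - t)) (f t) y
      = -(f t * fderiv ℝ φ t y) := fun t => by
    rw [hφd]; simp [mul_comm]
  simp only [e1]
  rw [integral_neg, h.2.2 φ hφ hφc y, neg_neg, convolution_lsmul_swap]
  have hg : Integrable fun t => ρ (x - t) • g t :=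
    h.2.1.integrable_smul_left_of_hasCompactSupport hφ.continuous hφc
  rw [← real_inner_comm, ← integral_inner hg]
  refine integral_congr_ae (Eventually.of_forall fun t => ?_)
  simp only [φ, inner_smul_right, real_inner_comm y]
  ring

/-- A sequence of mollifiers. -/
def mollifier (d n : ℕ) : ContDiffBump (0 : Space d) where
  rIn := 1 / (n + 1)
  rOut := 2 / (n + 1)
  rIn_pos := by positivity
  rIn_lt_rOut := by gcongr; norm_num

theorem ae_tendsto_mollifier {E : Type*} [NormedAddCommGroup E] [NormedSpace ℝ E] [CompleteSpace E]
    {g : Space d → E} (hg : LocallyIntegrable g volume) :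
    ∀ᵐ x, Tendsto (fun n => ((mollifier d n).normed volume
      ⋆[ContinuousLinearMap.lsmul ℝ ℝ, volume] g) x) atTop (𝓝 (g x)) := by
  refine ContDiffBump.ae_convolution_tendsto_right_of_locallyIntegrable (K := 2) ?_ ?_ hg
  · exact tendsto_const_div_atTop_nhds_zero_nat 2 |>.comp (tendsto_add_atTop_nat 1) |>.congr
      fun n => by simp [mollifier]
  · exact Eventually.of_forall fun n => by simp only [mollifier]; apply le_of_eq; ring

/-- Smooth cutoffs, equal to one on large balls, with small gradients. -/
theorem exists_cutoff (d : ℕ) : ∃ (χ : ℕ → Space d → ℝ) (C : ℝ), (∀ n, ContDiff ℝ ∞ (χ n)) ∧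
    (∀ n, HasCompactSupport (χ n)) ∧ (∀ n x, 0 ≤ χ n x ∧ χ n x ≤ 1) ∧
    (∀ (n : ℕ) x, ‖x‖ ≤ n + 1 → χ n x = 1) ∧ ∀ (n : ℕ) x, ‖gradient (χ n) x‖ ≤ C / (n + 1) := by
  let b : ContDiffBump (0 : Space d) := ⟨1, 2, one_pos, one_lt_two⟩
  have hb : ContDiff ℝ 1 b := b.contDiff
  obtain ⟨C, hC⟩ := (b.hasCompactSupport.fderiv (𝕜 := ℝ)).exists_bound_of_continuous
    (hb.continuous_fderiv one_ne_zero)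
  have hpos : ∀ n : ℕ, (0 : ℝ) < n + 1 := fun n => by positivity
  refine ⟨fun n x => b (((n : ℝ) + 1)⁻¹ • x), C, fun n => b.contDiff.comp (contDiff_const_smul _),
    fun n => ?_, fun n x => ⟨b.nonneg, b.le_one⟩, fun n x hx => ?_, fun n x => ?_⟩
  · exact b.hasCompactSupport.comp_homeomorph
      (Homeomorph.smulOfNeZero ((n : ℝ) + 1)⁻¹ (inv_ne_zero (hpos n).ne'))
  · refine b.one_of_mem_closedBall ?_
    rw [mem_closedBall_zero_iff, norm_smul, norm_inv, Real.norm_of_nonneg (hpos n).le,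
      inv_mul_le_iff₀ (hpos n)]
    simpa [b] using hx
  · have h1 := (hb.differentiable one_ne_zero (((n : ℝ) + 1)⁻¹ • x)).hasFDerivAt
    have h2 : HasFDerivAt (fun x : Space d => ((n : ℝ) + 1)⁻¹ • x)
        (((n : ℝ) + 1)⁻¹ • ContinuousLinearMap.id ℝ (Space d)) x :=
      (hasFDerivAt_id x).fun_const_smul _
    have h3 : HasFDerivAt (fun x : Space d => b (((n : ℝ) + 1)⁻¹ • x)) _ x := h1.comp x h2
    rw [norm_gradient, h3.fderiv, ContinuousLinearMap.comp_smul, ContinuousLinearMap.comp_id,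
      norm_smul, norm_inv, Real.norm_of_nonneg (hpos n).le, div_eq_inv_mul]
    gcongr
    exact hC _

/-- Density of test functions in `H¹`, along a sequence that converges almost everywhere. -/
theorem HasWeakGradient.exists_approx {f : Space d → ℝ} {g : Space d → Space d}
    (h : HasWeakGradient f g) (hf : MemLp f 2 volume) (hg : MemLp g 2 volume) :
    ∃ u : ℕ → Space d → ℝ, (∀ n, ContDiff ℝ ∞ (u n)) ∧ (∀ n, HasCompactSupport (u n)) ∧
      (∀ᵐ x, Tendsto (fun n => u n x) atTop (𝓝 (f x))) ∧
      Tendsto (fun n => eLpNorm (u n - f) 2 volume) atTop (𝓝 0) ∧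
      Tendsto (fun n => eLpNorm (gradient (u n) - g) 2 volume) atTop (𝓝 0) := by
  obtain ⟨χ, C, hχs, hχc, hχ01, hχ1, hχg⟩ := exists_cutoff d
  let ρ : ℕ → Space d → ℝ := fun n => (mollifier d n).normed volume
  have hρs : ∀ n, ContDiff ℝ ∞ (ρ n) := fun n => (mollifier d n).contDiff_normed
  have hρc : ∀ n, HasCompactSupport (ρ n) := fun n => (mollifier d n).hasCompactSupport_normed
  let F : ℕ → Space d → ℝ := fun n => ρ n ⋆[ContinuousLinearMap.lsmul ℝ ℝ, volume] f
  let G : ℕ → Space d → Space d := fun n => ρ n ⋆[ContinuousLinearMap.lsmul ℝ ℝ, volume] g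
  have hFs : ∀ n, ContDiff ℝ ∞ (F n) := fun n =>
    (hρc n).contDiff_convolution_left _ (hρs n) h.1
  have hFG : ∀ n x, gradient (F n) x = G n x := fun n x => h.gradient_convolution (hρs n) (hρc n) x
  have hG : ∀ n, Continuous (G n) := fun n => by
    have := continuous_gradient ((hFs n).of_le (by exact_mod_cast le_top))
    exact (funext (hFG n)) ▸ this
  have hFle : ∀ n, eLpNorm (F n) 2 volume ≤ eLpNorm f 2 volume := fun n =>
    eLpNorm_two_convolution_le (hρs n).continuous (mollifier d n).nonneg_normed
      (mollifier d n).integrable_normed (mollifier d n).integral_normed hf.1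
  have hGle : ∀ n, eLpNorm (G n) 2 volume ≤ eLpNorm g 2 volume := fun n =>
    eLpNorm_two_convolution_le (hρs n).continuous (mollifier d n).nonneg_normed
      (mollifier d n).integrable_normed (mollifier d n).integral_normed hg.1
  have hχev : ∀ x, ∀ᶠ n in atTop, χ n x = 1 := fun x => by
    obtain ⟨N, hN⟩ := exists_nat_ge ‖x‖
    filter_upwards [eventually_ge_atTop N] with n hn
    refine hχ1 n x (hN.trans ?_)
    have : (N : ℝ) ≤ n := by exact_mod_cast hn
    linarith
  have hχn : ∀ n x, ‖χ n x‖ ≤ 1 := fun n x => by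
    rw [Real.norm_of_nonneg (hχ01 n x).1]; exact (hχ01 n x).2
  have hlimf : ∀ᵐ x, Tendsto (fun n => χ n x * F n x) atTop (𝓝 (f x)) := by
    filter_upwards [ae_tendsto_mollifier h.1] with x hx
    refine hx.congr' ?_
    filter_upwards [hχev x] with n hn
    rw [hn, one_mul]
  have hlimg : ∀ᵐ x, Tendsto (fun n => χ n x • G n x) atTop (𝓝 (g x)) := by
    filter_upwards [ae_tendsto_mollifier h.2.1] with x hx
    refine hx.congr' ?_
    filter_upwards [hχev x] with n hn
    rw [hn, one_smul]
  have hus : ∀ n, ContDiff ℝ ∞ fun x => χ n x * F n x := fun n => (hχs n).mul (hFs n)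
  have hGm : ∀ n, AEStronglyMeasurable (fun x => χ n x • G n x) volume := fun n =>
    ((hχs n).continuous.smul (hG n)).aestronglyMeasurable
  refine ⟨fun n x => χ n x * F n x, hus, fun n => (hχc n).mul_right, hlimf, ?_, ?_⟩
  · refine tendsto_eLpNorm_two_sub_of_ae_tendsto
      (fun n => (hus n).continuous.aestronglyMeasurable) hf (fun n => ?_) hlimf
    refine (eLpNorm_mono fun x => ?_).trans (hFle n)
    rw [norm_mul]
    exact mul_le_of_le_one_left (norm_nonneg _) (hχn n x)
  · have h1 : Tendsto (fun n => eLpNorm ((fun x => χ n x • G n x) - g) 2 volume) atTop (𝓝 0) := by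
      refine tendsto_eLpNorm_two_sub_of_ae_tendsto hGm hg (fun n => ?_) hlimg
      refine (eLpNorm_mono fun x => ?_).trans (hGle n)
      rw [norm_smul]
      exact mul_le_of_le_one_left (norm_nonneg _) (hχn n x)
    have hgm : ∀ n, AEStronglyMeasurable (fun x => F n x • gradient (χ n) x) volume := fun n =>
      ((hFs n).continuous.smul
        (continuous_gradient ((hχs n).of_le (by exact_mod_cast le_top)))).aestronglyMeasurable
    -- The cross term of the product rule: the gradient of the cutoff is of order `1 / (n + 1)`,
    -- while the mollifications stay bounded in `L²`.
    have hb2 : ∀ n : ℕ, eLpNorm (fun x => F n x • gradient (χ n) x) 2 volume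
        ≤ ENNReal.ofReal (C / (n + 1)) * eLpNorm f 2 volume := fun n => by
      refine (eLpNorm_le_mul_eLpNorm_of_ae_le_mul (Eventually.of_forall fun x => ?_) 2).trans
        (mul_le_mul_right (hFle n) _)
      rw [norm_smul, mul_comm]
      exact mul_le_mul_of_nonneg_right (hχg n x) (norm_nonneg _)
    have h2 : Tendsto (fun n : ℕ => ENNReal.ofReal (C / (n + 1)) * eLpNorm f 2 volume)
        atTop (𝓝 0) := by
      have h3 : Tendsto (fun n : ℕ => C / ((n : ℝ) + 1)) atTop (𝓝 0) :=
        ((tendsto_const_div_atTop_nhds_zero_nat C).comp (tendsto_add_atTop_nat 1)).congr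
          fun n => by simp
      have h4 := ENNReal.Tendsto.mul_const (ENNReal.tendsto_ofReal h3)
        (b := eLpNorm f 2 volume) (Or.inr hf.eLpNorm_ne_top)
      simpa using h4
    have h5 := h1.add h2
    rw [zero_add] at h5
    refine tendsto_of_tendsto_of_tendsto_of_le_of_le tendsto_const_nhds h5 (fun _ => zero_le)
      fun n => ?_
    have e : gradient (fun x => χ n x * F n x) - g
        = ((fun x => χ n x • G n x) - g) + fun x => F n x • gradient (χ n) x := by
      funext x
      have := gradient_mul (((hχs n).differentiable (by simp)) x)
        (((hFs n).differentiable (by simp)) x)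
      simp only [Pi.sub_apply, Pi.add_apply, this, hFG]
      abel
    simp only
    rw [e]
    exact (eLpNorm_add_le ((hGm n).sub hg.1) (hgm n) one_le_two).trans
      (add_le_add le_rfl (hb2 n))

/-! ### Calculus of weak gradients: limits, products, chain rule -/

theorem continuous_fderiv_apply {φ : Space d → ℝ} (hφ : ContDiff ℝ 1 φ) (y : Space d) :
    Continuous fun x => fderiv ℝ φ x y :=
  (hφ.continuous_fderiv one_ne_zero).clm_apply continuous_const

theorem hasCompactSupport_fderiv_dir {φ : Space d → ℝ} (hφ : HasCompactSupport φ)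
    (y : Space d) : HasCompactSupport fun x => fderiv ℝ φ x y :=
  (hφ.fderiv (𝕜 := ℝ)).comp_left (g := fun L : Space d →L[ℝ] ℝ => L y) rfl

theorem locallyIntegrable_norm {E : Type*} [NormedAddCommGroup E] {f : Space d → E}
    (hf : LocallyIntegrable f volume) : LocallyIntegrable (fun x => ‖f x‖) volume :=
  hf.mono hf.aestronglyMeasurable.norm (Eventually.of_forall fun x => by simp)

theorem integrable_mul_test {f : Space d → ℝ} (hf : LocallyIntegrable f volume) {φ : Space d → ℝ}
    (hφ : Continuous φ) (hc : HasCompactSupport φ) : Integrable fun x => f x * φ x := by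
  simpa only [smul_eq_mul, mul_comm] using hf.integrable_smul_left_of_hasCompactSupport hφ hc

theorem integral_inner_mul_test {g : Space d → Space d} (hg : LocallyIntegrable g volume)
    {φ : Space d → ℝ} (hφ : Continuous φ) (hc : HasCompactSupport φ) (y : Space d) :
    ∫ x, inner ℝ (g x) y * φ x = inner ℝ (∫ x, φ x • g x) y := by
  rw [real_inner_comm, ← integral_inner (hg.integrable_smul_left_of_hasCompactSupport hφ hc)]
  refine integral_congr_ae (Eventually.of_forall fun x => ?_)
  simp only [inner_smul_right, real_inner_comm y]
  ring

theorem HasWeakGradient.of_contDiff {u : Space d → ℝ} (hu : ContDiff ℝ 1 u) :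
    HasWeakGradient u (gradient u) := by
  refine ⟨hu.continuous.locallyIntegrable, (continuous_gradient hu).locallyIntegrable,
    fun φ hφ hc y => ?_⟩
  have hφ1 : ContDiff ℝ 1 φ := hφ.of_le (by exact_mod_cast le_top)
  simp only [inner_gradient]
  have hL : LocallyIntegrable (fun x => fderiv ℝ u x y) volume :=
    (continuous_fderiv_apply hu y).locallyIntegrable
  exact integral_mul_fderiv_eq_neg_fderiv_mul_of_integrable
    (integrable_mul_test hL hφ.continuous hc)
    (integrable_mul_test hu.continuous.locallyIntegrable (continuous_fderiv_apply hφ1 y)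
      (hasCompactSupport_fderiv_dir hc y))
    (integrable_mul_test hu.continuous.locallyIntegrable hφ.continuous hc)
    (fun x _ => hu.differentiable one_ne_zero x) (fun x _ => hφ1.differentiable one_ne_zero x)

theorem HasWeakGradient.congr_ae {f f' : Space d → ℝ} {g g' : Space d → Space d}
    (h : HasWeakGradient f g) (hf : f =ᵐ[volume] f') (hg : g =ᵐ[volume] g') :
    HasWeakGradient f' g' := by
  refine ⟨(locallyIntegrable_congr hf).1 h.1, (locallyIntegrable_congr hg).1 h.2.1,
    fun φ hφ hc y => ?_⟩
  have e1 : ∫ x, f' x * fderiv ℝ φ x y = ∫ x, f x * fderiv ℝ φ x y :=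
    integral_congr_ae (by filter_upwards [hf] with x hx; rw [hx])
  have e2 : ∫ x, inner ℝ (g' x) y * φ x = ∫ x, inner ℝ (g x) y * φ x :=
    integral_congr_ae (by filter_upwards [hg] with x hx; rw [hx])
  rw [e1, e2, h.2.2 φ hφ hc y]

theorem HasWeakGradient.add {f f' : Space d → ℝ} {g g' : Space d → Space d}
    (h : HasWeakGradient f g) (h' : HasWeakGradient f' g') : HasWeakGradient (f + f') (g + g') := by
  refine ⟨h.1.add h'.1, h.2.1.add h'.2.1, fun φ hφ hc y => ?_⟩
  have hφ1 : ContDiff ℝ 1 φ := hφ.of_le (by exact_mod_cast le_top)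
  have hi : ∀ {k : Space d → ℝ}, LocallyIntegrable k volume →
      Integrable fun x => k x * fderiv ℝ φ x y := fun hk => integrable_mul_test hk
    (continuous_fderiv_apply hφ1 y) (hasCompactSupport_fderiv_dir hc y)
  have hs : ∀ {k : Space d → Space d}, LocallyIntegrable k volume →
      Integrable fun x => φ x • k x := fun hk =>
    hk.integrable_smul_left_of_hasCompactSupport hφ.continuous hc
  rw [integral_inner_mul_test (h.2.1.add h'.2.1) hφ.continuous hc]
  simp only [Pi.add_apply, add_mul, smul_add]
  rw [integral_add (hi h.1) (hi h'.1), integral_add (hs h.2.1) (hs h'.2.1), inner_add_left,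
    h.2.2 φ hφ hc y, h'.2.2 φ hφ hc y, integral_inner_mul_test h.2.1 hφ.continuous hc,
    integral_inner_mul_test h'.2.1 hφ.continuous hc]
  ring

theorem HasWeakGradient.const_smul {f : Space d → ℝ} {g : Space d → Space d}
    (h : HasWeakGradient f g) (c : ℝ) : HasWeakGradient (c • f) (c • g) := by
  refine ⟨h.1.smul c, h.2.1.smul c, fun φ hφ hc y => ?_⟩
  simp only [Pi.smul_apply, smul_eq_mul, inner_smul_left, mul_assoc, integral_const_mul,
    h.2.2 φ hφ hc y, conj_trivial]
  ring

/-- Product of a weakly differentiable function with a smooth function. -/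
theorem HasWeakGradient.smooth_mul {f : Space d → ℝ} {g : Space d → Space d}
    (h : HasWeakGradient f g) {θ : Space d → ℝ} (hθ : ContDiff ℝ ∞ θ) :
    HasWeakGradient (fun x => θ x * f x) (fun x => θ x • g x + f x • gradient θ x) := by
  have hθ1 : ContDiff ℝ 1 θ := hθ.of_le (by exact_mod_cast le_top)
  have lf : LocallyIntegrable (fun x => θ x * f x) volume := by
    simpa only [smul_eq_mul] using h.1.continuous_smul hθ.continuous
  have lg : LocallyIntegrable (fun x => θ x • g x) volume := h.2.1.continuous_smul hθ.continuous
  have lr : LocallyIntegrable (fun x => f x • gradient θ x) volume := by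
    have hc := continuous_gradient hθ1
    rw [locallyIntegrable_iff]
    intro K hK
    have hfK := h.1.integrableOn_isCompact hK
    obtain ⟨C, hC⟩ := hK.exists_bound_of_continuousOn hc.continuousOn
    refine (hfK.norm.mul_const C).mono'
      (hfK.aestronglyMeasurable.smul hc.aestronglyMeasurable) ?_
    filter_upwards [ae_restrict_mem hK.measurableSet] with x hx
    rw [norm_smul]
    exact mul_le_mul_of_nonneg_left (hC x hx) (norm_nonneg _)
  refine ⟨lf, lg.add lr, fun φ hφ hc y => ?_⟩
  have hφ1 : ContDiff ℝ 1 φ := hφ.of_le (by exact_mod_cast le_top)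
  -- The factor `θ` is moved into the test function.
  have key := h.2.2 (fun x => θ x * φ x) (hθ.mul hφ) hc.mul_left y
  have hd : ∀ x, fderiv ℝ (fun x => θ x * φ x) x y
      = θ x * fderiv ℝ φ x y + φ x * fderiv ℝ θ x y := fun x => by
    rw [fderiv_fun_mul (hθ1.differentiable one_ne_zero x) (hφ1.differentiable one_ne_zero x)]
    simp
  have i1 : Integrable fun x => θ x * f x * fderiv ℝ φ x y := integrable_mul_test lf
    (continuous_fderiv_apply hφ1 y) (hasCompactSupport_fderiv_dir hc y)
  have i2 : Integrable fun x => f x * (φ x * fderiv ℝ θ x y) := integrable_mul_test h.1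
    (hφ.continuous.mul (continuous_fderiv_apply hθ1 y)) hc.mul_right
  have i3 : Integrable fun x => inner ℝ (g x) y * (θ x * φ x) := by
    have := (h.2.1.integrable_smul_left_of_hasCompactSupport (hθ.continuous.mul hφ.continuous)
      (hc.mul_left (f := θ))).inner_const y (𝕜 := ℝ)
    refine this.congr (Eventually.of_forall fun x => ?_)
    simp only [Pi.mul_apply, inner_smul_left, conj_trivial]; ring
  have e1 : ∫ x, f x * fderiv ℝ (fun x => θ x * φ x) x y
      = (∫ x, θ x * f x * fderiv ℝ φ x y) + ∫ x, f x * (φ x * fderiv ℝ θ x y) := by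
    rw [← integral_add i1 i2]
    refine integral_congr_ae (Eventually.of_forall fun x => ?_)
    simp only [hd]; ring
  have e2 : ∫ x, inner ℝ (θ x • g x + f x • gradient θ x) y * φ x
      = (∫ x, inner ℝ (g x) y * (θ x * φ x)) + ∫ x, f x * (φ x * fderiv ℝ θ x y) := by
    rw [← integral_add i3 i2]
    refine integral_congr_ae (Eventually.of_forall fun x => ?_)
    simp only [inner_add_left, inner_smul_left, inner_gradient, conj_trivial]; ring
  rw [e2]
  rw [e1] at key
  linarith

/-- Weak gradients are closed under distributional limits. -/
theorem HasWeakGradient.of_tendsto {f : ℕ → Space d → ℝ} {g : ℕ → Space d → Space d}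
    {f' : Space d → ℝ} {g' : Space d → Space d} (h : ∀ n, HasWeakGradient (f n) (g n))
    (hf' : LocallyIntegrable f' volume) (hg' : LocallyIntegrable g' volume)
    (hf : ∀ φ : Space d → ℝ, Continuous φ → HasCompactSupport φ →
      Tendsto (fun n => ∫ x, φ x • f n x) atTop (𝓝 (∫ x, φ x • f' x)))
    (hg : ∀ φ : Space d → ℝ, Continuous φ → HasCompactSupport φ →
      Tendsto (fun n => ∫ x, φ x • g n x) atTop (𝓝 (∫ x, φ x • g' x))) :
    HasWeakGradient f' g' := by
  refine ⟨hf', hg', fun φ hφ hc y => ?_⟩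
  have hφ1 : ContDiff ℝ 1 φ := hφ.of_le (by exact_mod_cast le_top)
  have t1 := hf _ (continuous_fderiv_apply hφ1 y) (hasCompactSupport_fderiv_dir hc y)
  have t2 := ((hg φ hφ.continuous hc).inner (tendsto_const_nhds (x := y)) (𝕜 := ℝ)).neg
  rw [integral_inner_mul_test hg' hφ.continuous hc]
  simp only [smul_eq_mul, mul_comm (fderiv ℝ φ _ y)] at t1
  refine tendsto_nhds_unique t1 (t2.congr fun n => ?_)
  rw [(h n).2.2 φ hφ hc y, integral_inner_mul_test (h n).2.1 hφ.continuous hc]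

theorem tendsto_integral_smul_of_dominated {E : Type*} [NormedAddCommGroup E] [NormedSpace ℝ E]
    {f : ℕ → Space d → E} {f' : Space d → E} {B : Space d → ℝ}
    (hm : ∀ n, LocallyIntegrable (f n) volume) (hB : LocallyIntegrable B volume)
    (hb : ∀ n, ∀ᵐ x, ‖f n x‖ ≤ B x)
    (hl : ∀ᵐ x, Tendsto (fun n => f n x) atTop (𝓝 (f' x)))
    {φ : Space d → ℝ} (hφ : Continuous φ) (hc : HasCompactSupport φ) :
    Tendsto (fun n => ∫ x, φ x • f n x) atTop (𝓝 (∫ x, φ x • f' x)) := by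
  refine tendsto_integral_of_dominated_convergence (fun x => B x * ‖φ x‖)
    (fun n => ((hm n).integrable_smul_left_of_hasCompactSupport hφ hc).1)
    (integrable_mul_test hB hφ.norm hc.norm) (fun n => ?_) ?_
  · filter_upwards [hb n] with x hx
    rw [norm_smul, mul_comm]
    exact mul_le_mul_of_nonneg_right hx (norm_nonneg _)
  · filter_upwards [hl] with x hx using hx.const_smul _

/-- The form in which the limits `ε → 0` of the regularized modulus and of the regularized sign are
taken. -/
theorem HasWeakGradient.of_dominated {f : ℕ → Space d → ℝ} {g : ℕ → Space d → Space d}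
    {f' : Space d → ℝ} {g' : Space d → Space d} {B B' : Space d → ℝ}
    (h : ∀ n, HasWeakGradient (f n) (g n))
    (hf' : LocallyIntegrable f' volume) (hg' : LocallyIntegrable g' volume)
    (hB : LocallyIntegrable B volume) (hB' : LocallyIntegrable B' volume)
    (hfB : ∀ n, ∀ᵐ x, ‖f n x‖ ≤ B x) (hgB : ∀ n, ∀ᵐ x, ‖g n x‖ ≤ B' x)
    (hf : ∀ᵐ x, Tendsto (fun n => f n x) atTop (𝓝 (f' x)))
    (hg : ∀ᵐ x, Tendsto (fun n => g n x) atTop (𝓝 (g' x))) :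
    HasWeakGradient f' g' :=
  .of_tendsto h hf' hg'
    (fun _ hφ hc => tendsto_integral_smul_of_dominated (fun n => (h n).1) hB hfB hf hφ hc)
    (fun _ hφ hc => tendsto_integral_smul_of_dominated (fun n => (h n).2.1) hB' hgB hg hφ hc)

theorem tendsto_integral_smul_of_eLpNorm_two {E : Type*} [NormedAddCommGroup E] [NormedSpace ℝ E]
    {f : ℕ → Space d → E} {f' : Space d → E}
    (hf : ∀ n, LocallyIntegrable (f n) volume) (hf' : LocallyIntegrable f' volume)
    (hl : Tendsto (fun n => eLpNorm (f n - f') 2 volume) atTop (𝓝 0))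
    {φ : Space d → ℝ} (hφ : Continuous φ) (hc : HasCompactSupport φ) :
    Tendsto (fun n => ∫ x, φ x • f n x) atTop (𝓝 (∫ x, φ x • f' x)) := by
  have hφ2 : MemLp φ 2 volume := hφ.memLp_of_hasCompactSupport hc
  refine tendsto_integral_of_L1' _ (hf'.integrable_smul_left_of_hasCompactSupport hφ hc).1
    (Eventually.of_forall fun n => (hf n).integrable_smul_left_of_hasCompactSupport hφ hc) ?_
  have h2 := ENNReal.Tendsto.const_mul hl (a := eLpNorm φ 2 volume) (Or.inr hφ2.eLpNorm_ne_top)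
  rw [mul_zero] at h2
  refine tendsto_of_tendsto_of_tendsto_of_le_of_le tendsto_const_nhds h2 (fun _ => zero_le)
    fun n => ?_
  have e : ((fun x => φ x • f n x) - fun x => φ x • f' x) = φ • (f n - f') := by
    funext x; simp [smul_sub]
  simp only
  rw [e]
  exact eLpNorm_smul_le_mul_eLpNorm
    ((hf n).aestronglyMeasurable.sub hf'.aestronglyMeasurable) hφ2.1

/-- Chain rule for `H¹` functions. -/
theorem HasWeakGradient.comp {f : Space d → ℝ} {g : Space d → Space d}
    (h : HasWeakGradient f g) (hf : MemLp f 2 volume) (hg : MemLp g 2 volume)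
    {F F' : ℝ → ℝ} (hF : ∀ s, HasDerivAt F (F' s) s) (hF' : Continuous F') {L : ℝ}
    (hL : ∀ s, |F' s| ≤ L) :
    HasWeakGradient (fun x => F (f x)) (fun x => F' (f x) • g x) := by
  obtain ⟨u, hus, huc, hua, huf, hug⟩ := h.exists_approx hf hg
  have hL0 : 0 ≤ L := (abs_nonneg _).trans (hL 0)
  have hlip : ∀ s t, |F s - F t| ≤ L * |s - t| := fun s t =>
    convex_univ.norm_image_sub_le_of_norm_hasDerivWithin_le
      (fun x _ => (hF x).hasDerivWithinAt) (fun x _ => hL x) (Set.mem_univ t) (Set.mem_univ s)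
  have hFc : ContDiff ℝ 1 F := by
    rw [contDiff_one_iff_deriv]
    exact ⟨fun s => (hF s).differentiableAt, by rwa [funext fun s => (hF s).deriv]⟩
  have hu1 : ∀ n, ContDiff ℝ 1 (u n) := fun n => (hus n).of_le (by exact_mod_cast le_top)
  have hgrad : ∀ n, gradient (fun x => F (u n x)) = fun x => F' (u n x) • gradient (u n) x := by
    intro n
    funext x
    refine ext_inner_right ℝ fun y => ?_
    have h3 : HasFDerivAt (fun x => F (u n x)) _ x :=
      (hF (u n x)).comp_hasFDerivAt x ((hu1 n).differentiable one_ne_zero x).hasFDerivAt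
    rw [inner_gradient, h3.fderiv, inner_smul_left, inner_gradient]
    simp
  have hn : ∀ n, HasWeakGradient (fun x => F (u n x)) (fun x => F' (u n x) • gradient (u n) x) :=
    fun n => hgrad n ▸ HasWeakGradient.of_contDiff (hFc.comp (hu1 n))
  have lf : LocallyIntegrable (fun x => F (f x)) volume := by
    have hb : LocallyIntegrable (fun x => |F 0| + L * |f x|) volume :=
      (locallyIntegrable_const _).add ((locallyIntegrable_norm h.1).smul L)
    refine hb.mono (hFc.continuous.comp_aestronglyMeasurable hf.1)
      (Eventually.of_forall fun x => ?_)
    rw [Real.norm_of_nonneg (add_nonneg (abs_nonneg _) (mul_nonneg hL0 (abs_nonneg _)))]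
    have := hlip (f x) 0
    rw [sub_zero] at this
    have h2 := abs_sub_abs_le_abs_sub (F (f x)) (F 0)
    rw [Real.norm_eq_abs]
    linarith
  have mg : ∀ (k : Space d → ℝ), AEStronglyMeasurable k volume →
      ∀ G : Space d → Space d, LocallyIntegrable G volume →
      LocallyIntegrable (fun x => F' (k x) • G x) volume := by
    intro k hk G hG
    refine (hG.smul L).mono ((hF'.comp_aestronglyMeasurable hk).smul hG.aestronglyMeasurable)
      (Eventually.of_forall fun x => ?_)
    rw [norm_smul, Pi.smul_apply, norm_smul, Real.norm_of_nonneg hL0]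
    exact mul_le_mul_of_nonneg_right (hL _) (norm_nonneg _)
  have lu : ∀ n, AEStronglyMeasurable (u n) volume := fun n =>
    (hus n).continuous.aestronglyMeasurable
  have lgu : ∀ n, LocallyIntegrable (gradient (u n)) volume := fun n =>
    (continuous_gradient (hu1 n)).locallyIntegrable
  have scale : ∀ {E E' : Type} [NormedAddCommGroup E] [NormedAddCommGroup E']
      (p : ℕ → Space d → E) (q : ℕ → Space d → E'),
      (∀ n x, ‖p n x‖ ≤ L * ‖q n x‖) →
      Tendsto (fun n => eLpNorm (q n) 2 volume) atTop (𝓝 0) →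
      Tendsto (fun n => eLpNorm (p n) 2 volume) atTop (𝓝 0) := by
    intro E E' _ _ p q hpq hq
    have h2 := ENNReal.Tendsto.const_mul hq (a := ENNReal.ofReal L) (Or.inr ENNReal.ofReal_ne_top)
    rw [mul_zero] at h2
    exact tendsto_of_tendsto_of_tendsto_of_le_of_le tendsto_const_nhds h2 (fun _ => zero_le)
      fun n => eLpNorm_le_mul_eLpNorm_of_ae_le_mul (Eventually.of_forall fun x => hpq n x) 2
  refine .of_tendsto hn lf (mg f hf.1 g h.2.1) (fun φ hφ hc => ?_) (fun φ hφ hc => ?_)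
  · refine tendsto_integral_smul_of_eLpNorm_two (fun n => (hn n).1) lf ?_ hφ hc
    exact scale _ (fun n => u n - f) (fun n x => hlip _ _) huf
  -- Splitting `F'(uₙ) ∇uₙ = F'(uₙ) (∇uₙ - g) + F'(uₙ) g`: the first part tends to zero in `L²`
  -- since `F'` is bounded; the second is dominated by `L ‖g‖` and converges almost everywhere.
  · have t1 : Tendsto (fun n => ∫ x, φ x • F' (u n x) • (gradient (u n) - g) x) atTop
        (𝓝 (∫ x, φ x • (0 : Space d → Space d) x)) := by
      refine tendsto_integral_smul_of_eLpNorm_two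
        (fun n => mg _ (lu n) _ ((lgu n).sub h.2.1)) (locallyIntegrable_zero) ?_ hφ hc
      refine scale _ (fun n => gradient (u n) - g) (fun n x => ?_) hug
      change ‖F' (u n x) • (gradient (u n) - g) x - 0‖ ≤ _
      rw [sub_zero, norm_smul]
      exact mul_le_mul_of_nonneg_right (hL _) (norm_nonneg _)
    have t2 : Tendsto (fun n => ∫ x, φ x • F' (u n x) • g x) atTop
        (𝓝 (∫ x, φ x • F' (f x) • g x)) := by
      refine tendsto_integral_smul_of_dominated (B := fun x => L * ‖g x‖)
        (fun n => mg _ (lu n) _ h.2.1) ((locallyIntegrable_norm h.2.1).smul L) (fun n => ?_) ?_ hφ hc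
      · refine Eventually.of_forall fun x => ?_
        rw [norm_smul]
        exact mul_le_mul_of_nonneg_right (hL _) (norm_nonneg _)
      · filter_upwards [hua] with x hx
        exact ((hF'.tendsto _).comp hx).smul_const _
    have t3 := t1.add t2
    simp only [Pi.zero_apply, smul_zero, integral_zero, zero_add] at t3
    refine t3.congr fun n => ?_
    rw [← integral_add]
    · refine integral_congr_ae (Eventually.of_forall fun x => ?_)
      simp only [Pi.sub_apply, smul_sub, sub_add_cancel]
    · exact (mg _ (lu n) _ ((lgu n).sub h.2.1)).integrable_smul_left_of_hasCompactSupport hφ hc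
    · exact (mg _ (lu n) _ h.2.1).integrable_smul_left_of_hasCompactSupport hφ hc

/-! ### The regularized modulus and the weak gradient of `|f|` -/

theorem sq_add_sq_pos {ε : ℝ} (hε : 0 < ε) (s : ℝ) : 0 < s ^ 2 + ε ^ 2 := by positivity

theorem hasDerivAt_sqrt_sq_add_sq {ε : ℝ} (hε : 0 < ε) (s : ℝ) :
    HasDerivAt (fun s => √(s ^ 2 + ε ^ 2)) (s / √(s ^ 2 + ε ^ 2)) s := by
  have h := ((hasDerivAt_pow 2 s).add_const (ε ^ 2)).sqrt (sq_add_sq_pos hε s).ne'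
  refine h.congr_deriv ?_
  have := Real.sqrt_pos.2 (sq_add_sq_pos hε s)
  field_simp
  norm_num

theorem continuous_sqrt_sq_add_sq (ε : ℝ) : Continuous fun s : ℝ => √(s ^ 2 + ε ^ 2) := by
  fun_prop

theorem abs_le_sqrt_sq_add_sq (ε s : ℝ) : |s| ≤ √(s ^ 2 + ε ^ 2) :=
  Real.abs_le_sqrt (by nlinarith [sq_nonneg ε])

theorem abs_div_sqrt_sq_add_sq_le {ε : ℝ} (hε : 0 < ε) (s : ℝ) : |s / √(s ^ 2 + ε ^ 2)| ≤ 1 := by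
  have := Real.sqrt_pos.2 (sq_add_sq_pos hε s)
  rw [abs_div, abs_of_pos this, div_le_one this]
  exact abs_le_sqrt_sq_add_sq ε s

theorem tendsto_sqrt_sq_add_sq (s : ℝ) :
    Tendsto (fun n : ℕ => √(s ^ 2 + (1 / ((n : ℝ) + 1)) ^ 2)) atTop (𝓝 |s|) := by
  have h := ((tendsto_one_div_add_atTop_nhds_zero_nat (𝕜 := ℝ)).pow 2).const_add (s ^ 2)
  have h2 := h.sqrt
  simpa [Real.sqrt_sq_eq_abs] using h2

/-- At `s = 0` all quotients vanish, in agreement with `sign 0 = 0`. This value is what makes the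
gradient of a nonnegative function vanish on its zero set. -/
theorem tendsto_div_sqrt_sq_add_sq (s : ℝ) :
    Tendsto (fun n : ℕ => s / √(s ^ 2 + (1 / ((n : ℝ) + 1)) ^ 2)) atTop
      (𝓝 (SignType.sign s : ℝ)) := by
  rcases eq_or_ne s 0 with rfl | hs
  · simp
  have h := (tendsto_const_nhds (x := s)).div (tendsto_sqrt_sq_add_sq s) (abs_ne_zero.2 hs)
  have e : (SignType.sign s : ℝ) = s / |s| := by
    rw [eq_div_iff (abs_ne_zero.2 hs), sign_mul_abs]
  rw [e]
  exact h

theorem MemH1.hasWeakGradient {f : Space d → ℝ} (h : MemH1 f) :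
    HasWeakGradient f (weakGradient f) := by
  obtain ⟨g, -, hg⟩ := h.2
  exact hg.congr_ae (ae_eq_refl f) (weakGradient_ae_eq hg).symm

theorem MemH1.memLp_weakGradient {f : Space d → ℝ} (h : MemH1 f) :
    MemLp (weakGradient f) 2 volume := by
  obtain ⟨g, hg2, hg⟩ := h.2
  exact hg2.ae_eq (weakGradient_ae_eq hg).symm

theorem MemH1.congr_ae {f f' : Space d → ℝ} (h : MemH1 f) (e : f =ᵐ[volume] f') : MemH1 f' :=
  ⟨h.1.ae_eq e, _, h.memLp_weakGradient, h.hasWeakGradient.congr_ae e (ae_eq_refl _)⟩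

theorem MemH1.weakGradient_congr_ae {f f' : Space d → ℝ} (h : MemH1 f) (e : f =ᵐ[volume] f') :
    weakGradient f' =ᵐ[volume] weakGradient f :=
  weakGradient_ae_eq (h.hasWeakGradient.congr_ae e (ae_eq_refl _))

theorem MemH1.add {f g : Space d → ℝ} (hf : MemH1 f) (hg : MemH1 g) : MemH1 (f + g) :=
  ⟨hf.1.add hg.1, _, hf.memLp_weakGradient.add hg.memLp_weakGradient,
    hf.hasWeakGradient.add hg.hasWeakGradient⟩

theorem MemH1.const_smul {f : Space d → ℝ} (hf : MemH1 f) (c : ℝ) : MemH1 (c • f) :=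
  ⟨hf.1.const_smul c, _, hf.memLp_weakGradient.const_smul c, hf.hasWeakGradient.const_smul c⟩

theorem memH1_zero : MemH1 (0 : Space d → ℝ) :=
  ⟨MemLp.zero, 0, MemLp.zero, locallyIntegrable_zero, locallyIntegrable_zero, by simp⟩

/-- The weak gradient of `|f|` is `sign f • ∇f`. -/
theorem MemH1.hasWeakGradient_abs {f : Space d → ℝ} (h : MemH1 f) :
    HasWeakGradient (fun x => |f x|)
      (fun x => (SignType.sign (f x) : ℝ) • weakGradient f x) := by
  have hf := h.hasWeakGradient
  have hpos : ∀ n : ℕ, (0 : ℝ) < 1 / ((n : ℝ) + 1) := fun n => by positivity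
  have sign_le : ∀ s : ℝ, |(SignType.sign s : ℝ)| ≤ 1 := fun s => by
    rcases lt_trichotomy s 0 with hs | rfl | hs <;> simp [*]
  have hsm : ∀ᵐ x, Tendsto (fun n : ℕ => (f x / √(f x ^ 2 + (1 / ((n : ℝ) + 1)) ^ 2)) •
      weakGradient f x) atTop (𝓝 ((SignType.sign (f x) : ℝ) • weakGradient f x)) :=
    Eventually.of_forall fun x => (tendsto_div_sqrt_sq_add_sq (f x)).smul_const _
  have hn : ∀ n : ℕ, HasWeakGradient (fun x => √(f x ^ 2 + (1 / ((n : ℝ) + 1)) ^ 2))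
      (fun x => (f x / √(f x ^ 2 + (1 / ((n : ℝ) + 1)) ^ 2)) • weakGradient f x) := fun n => by
    refine hf.comp h.1 h.memLp_weakGradient (F := fun s => √(s ^ 2 + (1 / ((n : ℝ) + 1)) ^ 2))
      (F' := fun s => s / √(s ^ 2 + (1 / ((n : ℝ) + 1)) ^ 2))
      (fun s => hasDerivAt_sqrt_sq_add_sq (hpos n) s) ?_
      (fun s => abs_div_sqrt_sq_add_sq_le (hpos n) s)
    exact continuous_id.div (continuous_sqrt_sq_add_sq _)
      fun s => (Real.sqrt_pos.2 (sq_add_sq_pos (hpos n) s)).ne'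
  -- The dominating functions are `|f| + 1`, since the regularization parameter is at most one, and
  -- `‖∇f‖`.
  refine .of_dominated hn (locallyIntegrable_norm hf.1) ?_
    ((locallyIntegrable_norm hf.1).add (locallyIntegrable_const 1))
    (locallyIntegrable_norm hf.2.1) (fun n => ?_) (fun n => ?_)
    (Eventually.of_forall fun x => tendsto_sqrt_sq_add_sq (f x)) hsm
  · refine hf.2.1.mono (aestronglyMeasurable_of_tendsto_ae atTop
      (fun n => (hn n).2.1.aestronglyMeasurable) hsm) (Eventually.of_forall fun x => ?_)
    rw [norm_smul]
    exact mul_le_of_le_one_left (norm_nonneg _) (sign_le _)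
  · refine Eventually.of_forall fun x => ?_
    rw [Real.norm_of_nonneg (Real.sqrt_nonneg _)]
    have h1 : (1 : ℝ) / ((n : ℝ) + 1) ≤ 1 := by
      rw [div_le_one (by positivity)]; linarith [(Nat.cast_nonneg n : (0 : ℝ) ≤ n)]
    refine Real.sqrt_le_iff.2 ⟨add_nonneg (norm_nonneg _) zero_le_one, ?_⟩
    change f x ^ 2 + (1 / ((n : ℝ) + 1)) ^ 2 ≤ (|f x| + 1) ^ 2
    nlinarith [abs_nonneg (f x), sq_abs (f x), hpos n]
  · refine Eventually.of_forall fun x => ?_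
    rw [norm_smul]
    exact mul_le_of_le_one_left (norm_nonneg _) (abs_div_sqrt_sq_add_sq_le (hpos n) _)

theorem MemH1.weakGradient_abs {f : Space d → ℝ} (h : MemH1 f) :
    weakGradient (fun x => |f x|)
      =ᵐ[volume] fun x => (SignType.sign (f x) : ℝ) • weakGradient f x :=
  weakGradient_ae_eq h.hasWeakGradient_abs

theorem MemH1.norm_weakGradient_abs_le {f : Space d → ℝ} (h : MemH1 f) :
    ∀ᵐ x, ‖weakGradient (fun x => |f x|) x‖ ≤ ‖weakGradient f x‖ := by
  filter_upwards [h.weakGradient_abs] with x hx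
  rw [hx, norm_smul]
  refine mul_le_of_le_one_left (norm_nonneg _) ?_
  rcases lt_trichotomy (f x) 0 with hs | hs | hs <;> simp [hs]

theorem MemH1.abs {f : Space d → ℝ} (h : MemH1 f) : MemH1 (fun x => |f x|) := by
  refine ⟨h.1.norm, _, h.memLp_weakGradient.mono ?_ h.norm_weakGradient_abs_le,
    h.hasWeakGradient_abs.congr_ae (ae_eq_refl _) h.weakGradient_abs.symm⟩
  exact (h.hasWeakGradient_abs.2.1.aestronglyMeasurable).congr h.weakGradient_abs.symm

/-- The weak gradient of a nonnegative function vanishes where the function does. -/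
theorem MemH1.weakGradient_eq_zero_of_nonneg {f : Space d → ℝ} (h : MemH1 f) (h0 : ∀ x, 0 ≤ f x) :
    ∀ᵐ x, f x = 0 → weakGradient f x = 0 := by
  -- As `f = |f|`, uniqueness of the weak gradient gives `∇f = sign f • ∇f`.
  have e : (fun x => |f x|) = f := funext fun x => abs_of_nonneg (h0 x)
  have := h.weakGradient_abs
  rw [e] at this
  filter_upwards [this] with x hx h0
  rw [hx, h0]; simp

/-! ### Sobolev embeddings and integrability of `v f²` -/

theorem lintegral_enorm_mul_enorm_le {α E F : Type*} [MeasurableSpace α] {μ : Measure α}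
    [NormedAddCommGroup E] [NormedAddCommGroup F] {a : α → E} {b : α → F}
    (ha : AEStronglyMeasurable a μ) (hb : AEStronglyMeasurable b μ) :
    ∫⁻ x, ‖a x‖ₑ * ‖b x‖ₑ ∂μ ≤ eLpNorm a 2 μ * eLpNorm b 2 μ := by
  have h := ENNReal.lintegral_mul_le_Lp_mul_Lq μ Real.HolderConjugate.two_two ha.enorm hb.enorm
  have e : ∀ {G : Type _} [NormedAddCommGroup G] (c : α → G),
      eLpNorm c 2 μ = (∫⁻ x, ‖c x‖ₑ ^ (2 : ℝ) ∂μ) ^ (1 / (2 : ℝ)) := fun c => by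
    simp [eLpNorm_eq_lintegral_rpow_enorm_toReal two_ne_zero ENNReal.ofNat_ne_top]
  rw [e a]
  have e' : eLpNorm b 2 μ = (∫⁻ x, ‖b x‖ₑ ^ (2 : ℝ) ∂μ) ^ (1 / (2 : ℝ)) := by
    simp [eLpNorm_eq_lintegral_rpow_enorm_toReal two_ne_zero ENNReal.ofNat_ne_top]
  rw [e']
  exact h

theorem eLpNorm_fderiv_eq (u : Space d → ℝ) (p : ℝ≥0∞) :
    eLpNorm (fderiv ℝ u) p volume = eLpNorm (gradient u) p volume :=
  eLpNorm_congr_norm_ae (Eventually.of_forall fun x => (norm_gradient u x).symm)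

/-- An a priori estimate for test functions gives an embedding of `H¹`. -/
theorem MemH1.memLp_of_forall_test {q : ℝ≥0∞}
    (hq : ∀ A : ℝ≥0∞, A ≠ ⊤ → ∃ B : ℝ≥0∞, B ≠ ⊤ ∧ ∀ u : Space d → ℝ, ContDiff ℝ 1 u →
      HasCompactSupport u → eLpNorm u 2 volume ≤ A → eLpNorm (fderiv ℝ u) 2 volume ≤ A →
      eLpNorm u q volume ≤ B)
    {f : Space d → ℝ} (hf : MemH1 f) : MemLp f q volume := by
  obtain ⟨u, hus, huc, hua, huf, hug⟩ := hf.hasWeakGradient.exists_approx hf.1 hf.memLp_weakGradient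
  have hu1 : ∀ n, ContDiff ℝ 1 (u n) := fun n => (hus n).of_le (by exact_mod_cast le_top)
  -- The added ones absorb the approximation errors; the sum bounds both norms of late approximants
  -- at once.
  set A : ℝ≥0∞ := (1 + eLpNorm f 2 volume) + (1 + eLpNorm (weakGradient f) 2 volume)
  have hA : A ≠ ⊤ := ENNReal.add_ne_top.2
    ⟨ENNReal.add_ne_top.2 ⟨ENNReal.one_ne_top, hf.1.eLpNorm_ne_top⟩,
      ENNReal.add_ne_top.2 ⟨ENNReal.one_ne_top, hf.memLp_weakGradient.eLpNorm_ne_top⟩⟩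
  obtain ⟨B, hB, hAB⟩ := hq A hA
  have hle : eLpNorm f q volume ≤ B := by
    refine Lp.eLpNorm_le_of_ae_tendsto ?_ (fun n => (hus n).continuous.aestronglyMeasurable) hua
    have e1 := huf.eventually (gt_mem_nhds (zero_lt_one (α := ℝ≥0∞)))
    have e2 := hug.eventually (gt_mem_nhds (zero_lt_one (α := ℝ≥0∞)))
    filter_upwards [e1, e2] with n h1 h2
    refine hAB (u n) (hu1 n) (huc n) ?_ ?_
    · have : u n = (u n - f) + f := by simp
      rw [this]
      refine (eLpNorm_add_le ((hus n).continuous.aestronglyMeasurable.sub hf.1.1) hf.1.1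
        one_le_two).trans (le_add_right ?_)
      gcongr
    · have : gradient (u n) = (gradient (u n) - weakGradient f) + weakGradient f := by simp
      rw [eLpNorm_fderiv_eq, this]
      refine (eLpNorm_add_le ((continuous_gradient (hu1 n)).aestronglyMeasurable.sub
        hf.memLp_weakGradient.1) hf.memLp_weakGradient.1 one_le_two).trans (le_add_left ?_)
      gcongr
  exact ⟨hf.1.1, hle.trans_lt hB.lt_top⟩

/-- Sobolev embedding in dimension at least three. -/
theorem MemH1.memLp_of_three_le (hd : 3 ≤ d) {q : NNReal} (hq : (q : ℝ)⁻¹ = 2⁻¹ - (d : ℝ)⁻¹)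
    {f : Space d → ℝ} (hf : MemH1 f) : MemLp f q volume := by
  refine hf.memLp_of_forall_test fun A hA =>
    ⟨eLpNormLESNormFDerivOfEqInnerConst (volume : Measure (Space d)) (2 : NNReal) * A,
      ENNReal.mul_ne_top ENNReal.coe_ne_top hA, fun u hu hc _ h2 => ?_⟩
  have hfin : Module.finrank ℝ (Space d) = d := by simp
  have h := eLpNorm_le_eLpNorm_fderiv_of_eq_inner (volume : Measure (Space d)) hu hc (p := 2)
    (p' := q) one_le_two (by rw [hfin]; omega) (by rw [hfin, hq]; norm_num)
  refine h.trans ?_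
  gcongr
  exact h2

/-- Ladyzhenskaya type estimates in dimension two. -/
theorem lintegral_pow_le_of_two (k : ℕ) (A : ℝ≥0∞) (hA : A ≠ ⊤) : ∃ B : ℝ≥0∞, B ≠ ⊤ ∧
    ∀ u : Space 2 → ℝ, ContDiff ℝ 1 u → HasCompactSupport u → eLpNorm u 2 volume ≤ A →
      eLpNorm (fderiv ℝ u) 2 volume ≤ A → eLpNorm (fun x => u x ^ (k + 1)) 2 volume ≤ B := by
  induction k with
  | zero => exact ⟨A, hA, fun u _ _ h _ => by simpa using h⟩
  | succ k ih =>
    obtain ⟨B, hB, hAB⟩ := ih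
    let C := eLpNormLESNormFDerivOneConst (volume : Measure (Space 2)) (2 : NNReal)
    refine ⟨C * ((k + 2 : ℕ) * (B * A)), ENNReal.mul_ne_top ENNReal.coe_ne_top
      (ENNReal.mul_ne_top (ENNReal.natCast_ne_top _) (ENNReal.mul_ne_top hB hA)),
      fun u hu hc h1 h2 => ?_⟩
    have hfin : Module.finrank ℝ (Space 2) = 2 := by simp
    have hconj : NNReal.HolderConjugate (Module.finrank ℝ (Space 2) : NNReal) 2 := by
      rw [hfin, NNReal.holderConjugate_iff]; norm_num
    have hpow : HasCompactSupport fun x => u x ^ (k + 1 + 1) :=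
      hc.comp_left (g := fun s : ℝ => s ^ (k + 1 + 1)) (by simp)
    -- The embedding of `W^{1,1}` into `L²` is applied to `u^(k+2)`. Its gradient `(k+2) u^(k+1) ∇u`
    -- is bounded in `L¹` by Cauchy–Schwarz and the induction hypothesis.
    have hgns := eLpNorm_le_eLpNorm_fderiv_one (volume : Measure (Space 2))
      (hu.pow (k + 1 + 1)) hpow hconj
    refine hgns.trans ?_
    gcongr
    have hd : ∀ x, ‖fderiv ℝ (fun x => u x ^ (k + 1 + 1)) x‖ₑ
        = (k + 2 : ℕ) * (‖u x ^ (k + 1)‖ₑ * ‖fderiv ℝ u x‖ₑ) := fun x => by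
      have h3 := (hu.differentiable one_ne_zero x).hasFDerivAt.pow (k + 1 + 1)
      rw [h3.fderiv, nsmul_eq_mul, enorm_smul, enorm_mul]
      have h4 : ‖((k + 1 + 1 : ℕ) : ℝ)‖ₑ = (k + 2 : ℕ) := by
        rw [← ofReal_norm, Real.norm_natCast, ENNReal.ofReal_natCast]
      rw [h4, Nat.add_sub_cancel, mul_assoc]
    rw [eLpNorm_one_eq_lintegral_enorm]
    simp only [hd]
    rw [lintegral_const_mul' _ _ (ENNReal.natCast_ne_top _)]
    gcongr
    refine (lintegral_enorm_mul_enorm_le (hu.pow (k + 1)).continuous.aestronglyMeasurable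
      (hu.continuous_fderiv one_ne_zero).aestronglyMeasurable).trans ?_
    gcongr
    exact hAB u hu hc h1 h2

/-- In dimension two `H¹` functions have finite moments of all even orders. -/
theorem MemH1.memLp_pow_of_two (k : ℕ) {f : Space 2 → ℝ} (hf : MemH1 f) :
    MemLp f (2 * (k + 1) : ℕ) volume := by
  refine hf.memLp_of_forall_test fun A hA => ?_
  obtain ⟨B, hB, hAB⟩ := lintegral_pow_le_of_two k A hA
  have hk : (0 : ℝ) < (2 * (k + 1) : ℕ) := by positivity
  refine ⟨(B ^ 2) ^ ((2 * (k + 1) : ℕ) : ℝ)⁻¹, ?_, fun u hu hc h1 h2 => ?_⟩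
  · exact ENNReal.rpow_ne_top_of_nonneg (by positivity) (ENNReal.pow_ne_top hB)
  · have h3 := hAB u hu hc h1 h2
    have h4 : ∫⁻ x, ‖u x‖ₑ ^ (2 * (k + 1)) ≤ B ^ 2 := by
      have : eLpNorm (fun x => u x ^ (k + 1)) 2 volume ^ 2 ≤ B ^ 2 := by gcongr
      rw [eLpNorm_two_sq] at this
      refine le_trans (le_of_eq (lintegral_congr fun x => ?_)) this
      rw [enorm_pow, ← pow_mul, mul_comm 2]
    rw [ENNReal.le_rpow_inv_iff hk]
    have h5 := eLpNorm_nnreal_pow_eq_lintegral (f := u) (μ := volume)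
      (p := ((2 * (k + 1) : ℕ) : NNReal)) (by positivity)
    have h6 : eLpNorm u ((2 * (k + 1) : ℕ) : ℝ≥0∞) volume ^ ((2 * (k + 1) : ℕ) : ℝ)
        = ∫⁻ x, ‖u x‖ₑ ^ ((2 * (k + 1) : ℕ) : ℝ) := by
      simpa only [NNReal.coe_natCast, ENNReal.coe_natCast] using h5
    rw [h6]
    simpa only [ENNReal.rpow_natCast] using h4

/-- In dimension one `H¹` functions are bounded. -/
theorem MemH1.memLp_top_of_one {f : Space 1 → ℝ} (hf : MemH1 f) : MemLp f ⊤ volume := by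
  refine hf.memLp_of_forall_test fun A hA => ⟨(2 * (A * A)) ^ (2 : ℝ)⁻¹, ?_,
    fun u hu hc h1 h2 => ?_⟩
  · exact ENNReal.rpow_ne_top_of_nonneg (by positivity)
      (ENNReal.mul_ne_top ENNReal.ofNat_ne_top (ENNReal.mul_ne_top hA hA))
  let e : ℝ ≃ₗᵢ[ℝ] Space 1 := (OrthonormalBasis.singleton (Fin 1) ℝ).repr
  -- The square is used because its derivative `2 u u'` is controlled in `L¹` by the two `L²` norms;
  -- integrating it over a half line bounds `u²`.
  let w : ℝ → ℝ := fun t => u (e t) ^ 2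
  have hw : ContDiff ℝ 1 w := (hu.comp e.toContinuousLinearEquiv.contDiff).pow 2
  have hwc : HasCompactSupport w :=
    (hc.comp_homeomorph e.toHomeomorph).comp_left (g := fun s : ℝ => s ^ 2) (by simp)
  have hdw : ∀ t, ‖deriv w t‖ₑ ≤ 2 * (‖u (e t)‖ₑ * ‖fderiv ℝ u (e t)‖ₑ) := fun t => by
    have h3 := (hu.differentiable one_ne_zero (e t)).hasFDerivAt.comp_hasDerivAt t
      (e.toContinuousLinearEquiv.hasFDerivAt (x := t)).hasDerivAt
    have h4 : HasDerivAt w _ t := h3.pow 2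
    rw [h4.deriv]
    have h5 : ‖fderiv ℝ u (e t) (e 1)‖ₑ ≤ ‖fderiv ℝ u (e t)‖ₑ := by
      have := (fderiv ℝ u (e t)).le_opENorm (e 1)
      have h6 : ‖e 1‖ₑ = 1 := by rw [← ofReal_norm, e.norm_map]; simp
      rwa [h6, mul_one] at this
    have h7 : ‖(2 : ℝ)‖ₑ = 2 := by simp [enorm_eq_nnnorm]
    simp only [enorm_mul, Nat.cast_ofNat, Nat.add_one_sub_one, pow_one, h7, mul_assoc,
      Function.comp]
    gcongr
    exact h5
  have hbound : ∀ x, ‖u x‖ₑ ^ 2 ≤ 2 * (A * A) := fun x => by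
    have h3 := hwc.enorm_le_lintegral_Ici_deriv hw (e.symm x)
    have h4 : ‖w (e.symm x)‖ₑ = ‖u x‖ₑ ^ 2 := by simp only [w, e.apply_symm_apply, enorm_pow]
    rw [h4] at h3
    refine h3.trans ((setLIntegral_le_lintegral _ _).trans ((lintegral_mono hdw).trans ?_))
    rw [lintegral_const_mul' _ _ ENNReal.ofNat_ne_top]
    gcongr
    rw [e.measurePreserving.lintegral_comp_emb e.toHomeomorph.measurableEmbedding
      (fun x => ‖u x‖ₑ * ‖fderiv ℝ u x‖ₑ)]
    refine (lintegral_enorm_mul_enorm_le hu.continuous.aestronglyMeasurable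
      (hu.continuous_fderiv one_ne_zero).aestronglyMeasurable).trans ?_
    gcongr
  rw [eLpNorm_exponent_top]
  refine essSup_le_of_ae_le _ (Eventually.of_forall fun x => ?_)
  rw [ENNReal.le_rpow_inv_iff two_pos, ENNReal.rpow_two]
  exact hbound x

theorem integrable_mul_of_young {α : Type*} [MeasurableSpace α] {μ : Measure α} {p q : ℝ}
    (hpq : p.HolderConjugate q) {v F : α → ℝ} (hv : AEStronglyMeasurable v μ)
    (hF : AEStronglyMeasurable F μ) (hvi : Integrable (fun x => |v x| ^ p) μ)
    (hFi : Integrable (fun x => |F x| ^ q) μ) : Integrable (fun x => v x * F x) μ := by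
  refine ((hvi.div_const p).add (hFi.div_const q)).mono' (hv.mul hF)
    (Eventually.of_forall fun x => ?_)
  rw [norm_mul]
  exact Real.young_inequality_of_nonneg (abs_nonneg _) (abs_nonneg _) hpq

/-- `v f²` is integrable for `v ∈ Yᵈ` and `f ∈ H¹`. -/
theorem MemY.integrable_mul_sq {v f : Space d → ℝ} (hv : MemY v) (hf : MemH1 f) :
    Integrable fun x => v x * f x ^ 2 := by
  obtain ⟨p, hp, v₁, v₂, h1, h2, rfl⟩ := hv
  have hf2 : Integrable fun x => f x ^ 2 := hf.1.integrable_sq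
  have i2 : Integrable fun x => v₂ x * f x ^ 2 := hf2.mul_of_top_right h2
  suffices i1 : Integrable fun x => v₁ x * f x ^ 2 by
    refine (i1.add i2).congr (Eventually.of_forall fun x => ?_)
    simp only [Pi.add_apply]; ring
  have hfm : AEStronglyMeasurable (fun x => f x ^ 2) volume := hf2.1
  -- In each case `f²` lies in the dual of `Lᵖ`: `f` is bounded if `d = 1`, has all even moments if
  -- `d = 2`, and lies in `L^(2d/(d-2))` if `d ≥ 3`, where `d/(d-2)` is conjugate to `d/2`.
  rcases hp with ⟨rfl, rfl⟩ | ⟨rfl, hp⟩ | ⟨hd, rfl⟩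
  · have hb := hf.memLp_top_of_one
    have h3 : Integrable fun x => v₁ x * f x := (memLp_one_iff_integrable.1 h1).mul_of_top_left hb
    refine (h3.mul_of_top_left hb).congr (Eventually.of_forall fun x => ?_)
    simp only [Pi.mul_apply]; ring
  · rcases eq_or_ne p ⊤ with rfl | hpt
    · exact hf2.mul_of_top_right h1
    have hp1 : 1 < p.toReal := by
      rw [← ENNReal.toReal_one]
      exact (ENNReal.toReal_lt_toReal ENNReal.one_ne_top hpt).2 hp
    have hpq := Real.HolderConjugate.conjExponent hp1
    set q := Real.conjExponent p.toReal
    refine integrable_mul_of_young hpq h1.1 hfm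
      (h1.integrable_norm_rpow (zero_lt_one.trans hp).ne' hpt) ?_
    -- Since `1 ≤ q ≤ k + 1`, the power `(f²)^q` is at most `f² + (f²)^(k+1)`, according to whether
    -- `f² ≤ 1` or not.
    obtain ⟨k, hk⟩ := exists_nat_ge q
    have h3 := (hf.memLp_pow_of_two k).integrable_norm_pow (by positivity)
    refine (hf2.add h3).mono'
      ((Real.continuous_rpow_const hpq.symm.nonneg).comp_aestronglyMeasurable hfm.norm) ?_
    refine Eventually.of_forall fun x => ?_
    have h0 : 0 ≤ f x ^ 2 := sq_nonneg _
    rw [Real.norm_of_nonneg (by positivity), abs_of_nonneg h0, Pi.add_apply]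
    have e : ‖f x‖ ^ (2 * (k + 1)) = (f x ^ 2) ^ (k + 1) := by
      rw [pow_mul, Real.norm_eq_abs, sq_abs]
    rw [e]
    rcases le_total (f x ^ 2) 1 with h | h
    · have := Real.rpow_le_rpow_of_exponent_ge' h0 h zero_le_one hpq.symm.lt.le
      rw [Real.rpow_one] at this
      exact this.trans (le_add_of_nonneg_right (by positivity))
    · have := Real.rpow_le_rpow_of_exponent_le h (z := ((k + 1 : ℕ) : ℝ))
        (hk.trans (by push_cast; linarith))
      rw [Real.rpow_natCast] at this
      exact this.trans (le_add_of_nonneg_left h0)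
  · have hd3 : (3 : ℝ) ≤ d := by exact_mod_cast hd
    have hpr : ((d : ℝ≥0∞) / 2).toReal = (d : ℝ) / 2 := by simp
    have hpq : ((d : ℝ) / 2).HolderConjugate ((d : ℝ) / (d - 2)) := by
      rw [Real.holderConjugate_iff]
      refine ⟨by linarith, ?_⟩
      have : (d : ℝ) - 2 ≠ 0 := by linarith
      field_simp
      ring
    have hq0 : (0 : ℝ) < 2 * d / (d - 2) := div_pos (by linarith) (by linarith)
    refine integrable_mul_of_young hpq h1.1 hfm ?_ ?_
    · have := h1.integrable_norm_rpow (by simp; omega)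
        (ENNReal.div_ne_top (ENNReal.natCast_ne_top _) two_ne_zero)
      rwa [hpr] at this
    · have h3 := hf.memLp_of_three_le hd (q := (2 * d / (d - 2) : ℝ).toNNReal) (by
        have : (d : ℝ) - 2 ≠ 0 := by linarith
        rw [Real.coe_toNNReal _ hq0.le]
        field_simp)
      have h4 := h3.integrable_norm_rpow
        (by simpa using hq0)
        ENNReal.coe_ne_top
      refine h4.congr (Eventually.of_forall fun x => ?_)
      simp only [ENNReal.coe_toReal, Real.coe_toNNReal _ hq0.le, Real.norm_eq_abs]
      rw [abs_of_nonneg (sq_nonneg (f x)), ← sq_abs, ← Real.rpow_natCast,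
        ← Real.rpow_mul (abs_nonneg _)]
      congr 1
      push_cast
      ring

/-- `v f g` is integrable for `v ∈ Yᵈ` and `f, g ∈ H¹`. -/
theorem MemY.integrable_mul_mul {v f g : Space d → ℝ} (hv : MemY v) (hf : MemH1 f)
    (hg : MemH1 g) : Integrable fun x => v x * f x * g x := by
  -- Polarization.
  have h1 := (hv.integrable_mul_sq (hf.add hg))
  have h2 := h1.sub ((hv.integrable_mul_sq hf).add (hv.integrable_mul_sq hg))
  refine (h2.div_const 2).congr (Eventually.of_forall fun x => ?_)
  simp only [Pi.sub_apply, Pi.add_apply]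
  ring

/-! ### Trace minimization for a pair of symmetric forms -/

section BilinearForms

variable {V : Type*} [AddCommGroup V] [Module ℝ V]

/-- The discriminant is `4 A²`. The first order conditions below are extracted in this way. -/
theorem apply_eq_zero_of_quadratic_nonneg {A B : ℝ} (h : ∀ t : ℝ, 0 ≤ 2 * t * A + t ^ 2 * B) :
    A = 0 := by
  have := discrim_le_zero (a := B) (b := 2 * A) (c := 0) fun t => by
    have := h t
    nlinarith
  rw [discrim] at this
  nlinarith [sq_nonneg A]

/-- A null vector of a positive semidefinite form is in its kernel. -/
theorem apply_eq_zero_of_apply_self_eq_zero {q : V →ₗ[ℝ] V →ₗ[ℝ] ℝ}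
    (hsymm : ∀ x y, q x y = q y x) (hpos : ∀ x, 0 ≤ q x x) {f : V} (hf : q f f = 0) (w : V) :
    q f w = 0 := by
  refine apply_eq_zero_of_quadratic_nonneg (B := q w w) fun t => ?_
  have := hpos (f + t • w)
  simp only [map_add, map_smul, LinearMap.add_apply, LinearMap.smul_apply, smul_eq_mul, hf,
    hsymm w f] at this
  nlinarith

/-- Orthonormality of a family with respect to a bilinear form. -/
def FormOrthonormal {N : ℕ} (b : V →ₗ[ℝ] V →ₗ[ℝ] ℝ) (ψ : Fin N → V) : Prop :=
  ∀ i j, b (ψ i) (ψ j) = if i = j then 1 else 0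

/-- `ψ` minimizes the trace of `a` among all `b`-orthonormal families. -/
def IsTraceMinimizer {N : ℕ} (a b : V →ₗ[ℝ] V →ₗ[ℝ] ℝ) (ψ : Fin N → V) : Prop :=
  FormOrthonormal b ψ ∧ ∀ Ψ : Fin N → V, FormOrthonormal b Ψ →
    ∑ i, a (ψ i) (ψ i) ≤ ∑ i, a (Ψ i) (Ψ i)

variable {N : ℕ} {a b : V →ₗ[ℝ] V →ₗ[ℝ] ℝ} {ψ : Fin N → V}

/-- Replacing `ψ j` by the normalization of `ψ j + t w` keeps the family orthonormal, because `w` is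
orthogonal to all its members. Only the `j`-th term of the trace changes; the inequality is stated
with the normalizing factor cleared. -/
theorem IsTraceMinimizer.le_perturb (hb : ∀ x y, b x y = b y x) (hpos : ∀ x, 0 ≤ b x x)
    (ha : ∀ x y, a x y = a y x) (h : IsTraceMinimizer a b ψ) {w : V} (hw : ∀ i, b (ψ i) w = 0)
    (j : Fin N) (t : ℝ) :
    a (ψ j) (ψ j) * (1 + t ^ 2 * b w w)
      ≤ a (ψ j) (ψ j) + 2 * t * a (ψ j) w + t ^ 2 * a w w := by
  classical
  have hc : 0 < 1 + t ^ 2 * b w w := by have := hpos w; positivity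
  set c : ℝ := (√(1 + t ^ 2 * b w w))⁻¹ with hcdef
  have hc2 : c * c * (1 + t ^ 2 * b w w) = 1 := by
    rw [hcdef, ← mul_inv, Real.mul_self_sqrt hc.le, inv_mul_cancel₀ hc.ne']
  have hw' : ∀ i, b w (ψ i) = 0 := fun i => by rw [hb, hw]
  let Ψ : Fin N → V := fun i => if i = j then c • (ψ j + t • w) else ψ i
  have hΨ : FormOrthonormal b Ψ := fun i k => by
    by_cases hi : i = j <;> by_cases hk : k = j
    · subst hi hk
      simp only [Ψ, if_true, map_add, map_smul, LinearMap.add_apply, LinearMap.smul_apply,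
        smul_eq_mul, hw, hw', h.1 k k]
      linarith
    · subst hi
      simp [Ψ, hk, Ne.symm hk, hw', h.1 i k]
    · subst hk
      simp [Ψ, hi, hw, h.1 i k]
    · simp [Ψ, hi, hk, h.1 i k]
  have hle := h.2 Ψ hΨ
  rw [← Finset.add_sum_erase _ _ (Finset.mem_univ j),
    ← Finset.add_sum_erase _ (fun i => a (Ψ i) (Ψ i)) (Finset.mem_univ j)] at hle
  have e : ∑ i ∈ Finset.univ.erase j, a (Ψ i) (Ψ i) = ∑ i ∈ Finset.univ.erase j, a (ψ i) (ψ i) :=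
    Finset.sum_congr rfl fun i hi => by simp [Ψ, Finset.ne_of_mem_erase hi]
  rw [e, add_le_add_iff_right] at hle
  have e2 : a (Ψ j) (Ψ j) = c * c * (a (ψ j) (ψ j) + 2 * t * a (ψ j) w + t ^ 2 * a w w) := by
    simp only [Ψ, if_true, map_add, map_smul, LinearMap.add_apply, LinearMap.smul_apply,
        smul_eq_mul, ha w (ψ j)]
    ring
  rw [e2] at hle
  have := mul_le_mul_of_nonneg_right hle hc.le
  calc _ ≤ _ := this
    _ = (c * c * (1 + t ^ 2 * b w w)) * (a (ψ j) (ψ j) + 2 * t * a (ψ j) w + t ^ 2 * a w w) := by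
      ring
    _ = _ := by rw [hc2, one_mul]

/-- First order condition: `2 a (ψ j) w` is the linear coefficient in `t` of the difference of the
two sides of `le_perturb`. -/
theorem IsTraceMinimizer.apply_eq_zero (hb : ∀ x y, b x y = b y x) (hpos : ∀ x, 0 ≤ b x x)
    (ha : ∀ x y, a x y = a y x) (h : IsTraceMinimizer a b ψ) {w : V} (hw : ∀ i, b (ψ i) w = 0)
    (j : Fin N) : a (ψ j) w = 0 := by
  refine apply_eq_zero_of_quadratic_nonneg (B := a w w - a (ψ j) (ψ j) * b w w) fun t => ?_
  have := h.le_perturb hb hpos ha hw j t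
  linarith

/-- Second order condition: what remains of `le_perturb` once the linear term is gone. -/
theorem IsTraceMinimizer.mul_le (hb : ∀ x y, b x y = b y x) (hpos : ∀ x, 0 ≤ b x x)
    (ha : ∀ x y, a x y = a y x) (h : IsTraceMinimizer a b ψ) {w : V} (hw : ∀ i, b (ψ i) w = 0)
    (j : Fin N) : a (ψ j) (ψ j) * b w w ≤ a w w := by
  have h1 := h.le_perturb hb hpos ha hw j 1
  have h2 := h.apply_eq_zero hb hpos ha hw j
  rw [h2] at h1
  linarith

theorem FormOrthonormal.apply_sub_sum (h : FormOrthonormal b ψ) (w : V) (i : Fin N) :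
    b (ψ i) (w - ∑ k, b (ψ k) w • ψ k) = 0 := by
  simp [map_sub, map_sum, h i]

/-- A trace minimizer can be rotated so that it diagonalizes `a`. -/
theorem IsTraceMinimizer.exists_diagonal (ha : ∀ x y, a x y = a y x)
    (h : IsTraceMinimizer a b ψ) : ∃ (χ : Fin N → V) (μ : Fin N → ℝ), IsTraceMinimizer a b χ ∧
      ∀ i j, a (χ i) (χ j) = if i = j then μ j else 0 := by
  classical
  let M : Matrix (Fin N) (Fin N) ℝ := Matrix.of fun i j => a (ψ i) (ψ j)
  have hM : M.IsHermitian := by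
    ext i j
    simpa [M] using ha _ _
  let e := hM.eigenvectorBasis
  let χ : Fin N → V := fun k => ∑ i, e k i • ψ i
  have hort : ∀ k l, ∑ i, e k i * e l i = if k = l then 1 else 0 := fun k l => by
    have := (orthonormal_iff_ite.1 e.orthonormal) k l
    rw [← this, PiLp.inner_apply]
    simp [mul_comm]
  have hb1 : FormOrthonormal b χ := fun k l => by
    simp only [χ, map_sum, map_smul, LinearMap.sum_apply, LinearMap.smul_apply, smul_eq_mul,
      h.1 _ _, ← hort k l]
    simp [mul_comm]
  have ha1 : ∀ k l, a (χ k) (χ l) = if k = l then hM.eigenvalues l else 0 := fun k l => by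
    have h1 : ∀ i, ∑ j, M i j * e l j = hM.eigenvalues l * e l i := fun i => by
      have := congrFun (hM.mulVec_eigenvectorBasis l) i
      simpa [Matrix.mulVec, dotProduct] using this
    have h2 : a (χ k) (χ l) = ∑ i, e k i * ∑ j, M i j * e l j := by
      simp only [χ, map_sum, map_smul, LinearMap.sum_apply, LinearMap.smul_apply, smul_eq_mul, M,
        Matrix.of_apply,
        Finset.mul_sum]
      rw [Finset.sum_comm]
      refine Finset.sum_congr rfl fun i _ => Finset.sum_congr rfl fun j _ => ?_
      ring
    rw [h2]
    simp only [h1]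
    have h3 : ∑ i, e k i * (hM.eigenvalues l * e l i)
        = hM.eigenvalues l * ∑ i, e k i * e l i := by
      rw [Finset.mul_sum]
      exact Finset.sum_congr rfl fun i _ => by ring
    rw [h3, hort]
    simp
  refine ⟨χ, hM.eigenvalues, ⟨hb1, fun Ψ hΨ => ?_⟩, ha1⟩
  -- The trace is invariant under the orthogonal change of family, so minimality is inherited.
  have htr : ∑ i, a (χ i) (χ i) = ∑ i, a (ψ i) (ψ i) := by
    have := hM.trace_eq_sum_eigenvalues
    simp only [ha1, if_true]
    simpa [Matrix.trace, M] using this.symm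
  rw [htr]
  exact h.2 Ψ hΨ

/-- The Euler-Lagrange equations of a diagonalized trace minimizer. -/
theorem IsTraceMinimizer.apply_eq (hb : ∀ x y, b x y = b y x) (hpos : ∀ x, 0 ≤ b x x)
    (ha : ∀ x y, a x y = a y x) (h : IsTraceMinimizer a b ψ) {μ : Fin N → ℝ}
    (hμ : ∀ i j, a (ψ i) (ψ j) = if i = j then μ j else 0) (j : Fin N) (w : V) :
    a (ψ j) w = μ j * b (ψ j) w := by
  have := h.apply_eq_zero hb hpos ha (h.1.apply_sub_sum w) j
  simp only [map_sub, map_sum, map_smul, smul_eq_mul, hμ, mul_ite, mul_zero, Finset.sum_ite_eq,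
    Finset.mem_univ, if_true] at this
  linarith

/-- The lowest eigenvalue of a trace minimizer is the bottom of the form. -/
theorem IsTraceMinimizer.lowest_mul_le (hb : ∀ x y, b x y = b y x) (hpos : ∀ x, 0 ≤ b x x)
    (ha : ∀ x y, a x y = a y x) (h : IsTraceMinimizer a b ψ) {μ : Fin N → ℝ}
    (hμ : ∀ j w, a (ψ j) w = μ j * b (ψ j) w) {j : Fin N} (hj : ∀ i, μ j ≤ μ i) (f : V) :
    μ j * b f f ≤ a f f := by
  set c : Fin N → ℝ := fun i => b (ψ i) f
  -- The eigenvalue equations make the span and its orthogonal remainder `w` orthogonal for `a` as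
  -- well, so `a f f` splits. The second order condition bounds the part of `w`, minimality of `μ j`
  -- the part in the span.
  set w := f - ∑ k, c k • ψ k with hw
  have hw0 : ∀ i, b (ψ i) w = 0 := h.1.apply_sub_sum f
  have h1 := h.mul_le hb hpos ha hw0 j
  have hjj : a (ψ j) (ψ j) = μ j := by rw [hμ, h.1 j j]; simp
  have hl : ∀ (q : V →ₗ[ℝ] V →ₗ[ℝ] ℝ) x, q w x = q f x - ∑ i, c i * q (ψ i) x := fun q x => by
    simp [hw, LinearMap.sum_apply]
  have hr : ∀ (q : V →ₗ[ℝ] V →ₗ[ℝ] ℝ) x, q x w = q x f - ∑ i, c i * q x (ψ i) := fun q x => by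
    simp [hw]
  have hbw : b w w = b f f - ∑ i, c i ^ 2 := by
    rw [hl]
    simp only [hw0, mul_zero, Finset.sum_const_zero, sub_zero, hr, hb f (ψ _)]
    simp [c, sq]
  have haw : a w w = a f f - ∑ i, c i ^ 2 * μ i := by
    rw [hl]
    simp only [hμ, hw0, mul_zero, Finset.sum_const_zero, sub_zero, hr, ha f (ψ _)]
    congr 1
    exact Finset.sum_congr rfl fun i _ => by simp only [c]; ring
  rw [hjj, hbw, haw] at h1
  have h2 : ∑ i, c i ^ 2 * μ j ≤ ∑ i, c i ^ 2 * μ i :=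
    Finset.sum_le_sum fun i _ => mul_le_mul_of_nonneg_left (hj i) (sq_nonneg _)
  rw [← Finset.sum_mul] at h2
  linarith

/-- A normalized lowest eigenvector can be made a member of a trace minimizer, by reflecting a given
one. -/
theorem IsTraceMinimizer.exists_apply_eq (hb : ∀ x y, b x y = b y x) (hpos : ∀ x, 0 ≤ b x x)
    (h : IsTraceMinimizer a b ψ) {μ : Fin N → ℝ} (ha : ∀ x y, a x y = a y x)
    (hμ : ∀ j w, a (ψ j) w = μ j * b (ψ j) w) {j : Fin N} {f : V} (hf1 : b f f = 1)
    (hf : ∀ w, a f w = μ j * b f w) :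
    ∃ χ : Fin N → V, IsTraceMinimizer a b χ ∧ (∀ i w, a (χ i) w = μ i * b (χ i) w) ∧ χ j = f := by
  classical
  set u := f - ψ j with hu
  set β := b u u with hβ
  set s : ℝ := 2 / β with hs
  have hau : ∀ w, a u w = μ j * b u w := fun w => by
    simp only [hu, map_sub, LinearMap.sub_apply, hf, hμ]; ring
  -- If `β = 0`, division by zero gives `s = 0`, and the reflection `R` below is the identity.
  have hsβ : s * s * β = 2 * s := by
    rcases eq_or_ne β 0 with h0 | h0
    · simp [hs, h0]
    · rw [hs]; field_simp
  let R : V → V := fun x => x - (s * b u x) • u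
  have hbR : ∀ x w, b (R x) w = b x w - s * b u x * b u w := fun x w => by
    simp [R]
  have hRR : ∀ x y, b (R x) (R y) = b x y := fun x y => by
    rw [hbR, hb x, hbR, hb y x]
    have : b u (R y) = b u y - s * b u y * β := by rw [hb, hbR, hb y u]
    rw [this]
    linear_combination (b u x * b u y) * hsβ
  -- `u` is an eigenvector for `μ j`, hence `b`-orthogonal to every `ψ i` with `μ i ≠ μ j`. The
  -- reflection therefore mixes only equal eigenvalues.
  have haR : ∀ i w, a (R (ψ i)) w = μ i * b (R (ψ i)) w := fun i w => by
    have h1 : μ j * b u (ψ i) = μ i * b u (ψ i) := by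
      rw [← hau, ha, hμ, hb]
    have h2 : a (R (ψ i)) w = a (ψ i) w - s * b u (ψ i) * a u w := by simp [R]
    rw [h2, hbR, hμ, hau]
    linear_combination (-(s * b u w)) * h1
  have hRj : ∀ w, b (R (ψ j)) w = b f w := fun w => by
    have h1 : b u (ψ j) = b f (ψ j) - 1 := by simp [hu, h.1 j j]
    have h2 : β = 2 - 2 * b f (ψ j) := by
      rw [hβ]
      conv_lhs => rw [hu]
      simp only [map_sub, LinearMap.sub_apply, hf1, h.1 j j, hb (ψ j) f, if_true]
      ring
    have h3 : b u w = b f w - b (ψ j) w := by simp [hu]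
    rw [hbR]
    rcases eq_or_ne β 0 with h0 | h0
    · have h4 : b u w = 0 := apply_eq_zero_of_apply_self_eq_zero hb hpos h0 w
      rw [h4]; linarith
    · have h4 : s * b u (ψ j) = -1 := by
        rw [hs, h1, show b f (ψ j) - 1 = -β / 2 by linarith]
        field_simp
      rw [h4, h3]; ring
  have haf : ∀ w, a f w = a (R (ψ j)) w := fun w => by rw [haR, hRj, hf]
  -- `b` may be degenerate. When `β = 0`, `R (ψ j) = ψ j` agrees with `f` only modulo the kernel of
  -- `b`, so `f` itself is put in place `j`.
  let χ : Fin N → V := fun i => if i = j then f else R (ψ i)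
  have hbχ : ∀ i w, b (χ i) w = b (R (ψ i)) w := fun i w => by
    by_cases hi : i = j
    · subst hi; simp [χ, hRj]
    · simp [χ, hi]
  have haχ : ∀ i w, a (χ i) w = μ i * b (χ i) w := fun i w => by
    by_cases hi : i = j
    · subst hi; simp [χ, hf]
    · simp [χ, hi, haR]
  have hχ : FormOrthonormal b χ := fun i k => by
    rw [hbχ, hb, hbχ, hRR, hb, h.1]
  refine ⟨χ, ⟨hχ, fun Ψ hΨ => ?_⟩, haχ, by simp [χ]⟩
  have : ∑ i, a (χ i) (χ i) = ∑ i, a (ψ i) (ψ i) :=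
    Finset.sum_congr rfl fun i _ => by rw [haχ, hμ, hχ, h.1]
  rw [this]
  exact h.2 Ψ hΨ

end BilinearForms

/-! ### The forms on `H¹` and the translation of the variational problem -/

theorem MemH1.integrable_mul {f g : Space d → ℝ} (hf : MemH1 f) (hg : MemH1 g) :
    Integrable fun x => f x * g x :=
  hf.1.integrable_mul hg.1

theorem MemH1.integrable_inner {f g : Space d → ℝ} (hf : MemH1 f) (hg : MemH1 g) :
    Integrable fun x => (inner ℝ (weakGradient f x) (weakGradient g x) : ℝ) := by
  have hF := hf.memLp_weakGradient
  have hG := hg.memLp_weakGradient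
  refine (hF.norm.integrable_mul hG.norm).mono' (hF.1.inner hG.1) (Eventually.of_forall fun x => ?_)
  exact norm_inner_le_norm _ _

/-- The Sobolev space `H¹(ℝᵈ)` as a space of functions. -/
def H1 (d : ℕ) : Submodule ℝ (Space d → ℝ) where
  carrier := {f | MemH1 f}
  add_mem' hf hg := MemH1.add hf hg
  zero_mem' := memH1_zero
  smul_mem' c _ hf := MemH1.const_smul hf c

/-- The chosen representatives need not be additive pointwise; equality almost everywhere is enough
under the integral. -/
theorem H1.weakGradient_add (f g : H1 d) : weakGradient (f + g : H1 d).1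
    =ᵐ[volume] weakGradient f.1 + weakGradient g.1 :=
  weakGradient_ae_eq (f.2.hasWeakGradient.add g.2.hasWeakGradient)

theorem H1.weakGradient_smul (c : ℝ) (f : H1 d) :
    weakGradient (c • f : H1 d).1 =ᵐ[volume] c • weakGradient f.1 :=
  weakGradient_ae_eq (f.2.hasWeakGradient.const_smul c)

/-- The `L²` inner product on `H¹`. -/
def massForm (d : ℕ) : H1 d →ₗ[ℝ] H1 d →ₗ[ℝ] ℝ :=
  LinearMap.mk₂ ℝ (fun f g => ∫ x, f.1 x * g.1 x)
    (fun f f' g => by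
      rw [← integral_add (f.2.integrable_mul g.2) (f'.2.integrable_mul g.2)]
      exact integral_congr_ae (Eventually.of_forall fun x => by simp [add_mul]))
    (fun c f g => by
      rw [smul_eq_mul, ← integral_const_mul]
      exact integral_congr_ae (Eventually.of_forall fun x => by simp [mul_assoc]))
    (fun f g g' => by
      rw [← integral_add (f.2.integrable_mul g.2) (f.2.integrable_mul g'.2)]
      exact integral_congr_ae (Eventually.of_forall fun x => by simp [mul_add]))
    (fun c f g => by
      rw [smul_eq_mul, ← integral_const_mul]
      exact integral_congr_ae (Eventually.of_forall fun x => by simp; ring))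

theorem massForm_apply (f g : H1 d) : massForm d f g = ∫ x, f.1 x * g.1 x := rfl

theorem massForm_symm (f g : H1 d) : massForm d f g = massForm d g f := by
  simp only [massForm_apply, mul_comm]

theorem massForm_self (f : H1 d) : massForm d f f = ∫ x, f.1 x ^ 2 := by
  simp only [massForm_apply, sq]

theorem massForm_nonneg (f : H1 d) : 0 ≤ massForm d f f := by
  rw [massForm_self]
  exact integral_nonneg fun x => sq_nonneg _

/-- The Dirichlet form on `H¹`. -/
def dirichletForm (d : ℕ) : H1 d →ₗ[ℝ] H1 d →ₗ[ℝ] ℝ :=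
  LinearMap.mk₂ ℝ (fun f g => ∫ x, inner ℝ (weakGradient f.1 x) (weakGradient g.1 x))
    (fun f f' g => by
      rw [← integral_add (f.2.integrable_inner g.2) (f'.2.integrable_inner g.2)]
      refine integral_congr_ae ?_
      filter_upwards [H1.weakGradient_add f f'] with x hx
      rw [hx, Pi.add_apply, inner_add_left])
    (fun c f g => by
      rw [smul_eq_mul, ← integral_const_mul]
      refine integral_congr_ae ?_
      filter_upwards [H1.weakGradient_smul c f] with x hx
      rw [hx, Pi.smul_apply, inner_smul_left, conj_trivial])
    (fun f g g' => by
      rw [← integral_add (f.2.integrable_inner g.2) (f.2.integrable_inner g'.2)]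
      refine integral_congr_ae ?_
      filter_upwards [H1.weakGradient_add g g'] with x hx
      rw [hx, Pi.add_apply, inner_add_right])
    (fun c f g => by
      rw [smul_eq_mul, ← integral_const_mul]
      refine integral_congr_ae ?_
      filter_upwards [H1.weakGradient_smul c g] with x hx
      rw [hx, Pi.smul_apply, inner_smul_right])

/-- The form of a potential in `Yᵈ`. -/
def potentialForm {v : Space d → ℝ} (hv : MemY v) : H1 d →ₗ[ℝ] H1 d →ₗ[ℝ] ℝ :=
  LinearMap.mk₂ ℝ (fun f g => ∫ x, v x * f.1 x * g.1 x)
    (fun f f' g => by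
      rw [← integral_add (hv.integrable_mul_mul f.2 g.2) (hv.integrable_mul_mul f'.2 g.2)]
      exact integral_congr_ae (Eventually.of_forall fun x => by simp; ring))
    (fun c f g => by
      rw [smul_eq_mul, ← integral_const_mul]
      exact integral_congr_ae (Eventually.of_forall fun x => by simp; ring))
    (fun f g g' => by
      rw [← integral_add (hv.integrable_mul_mul f.2 g.2) (hv.integrable_mul_mul f.2 g'.2)]
      exact integral_congr_ae (Eventually.of_forall fun x => by simp; ring))
    (fun c f g => by
      rw [smul_eq_mul, ← integral_const_mul]
      exact integral_congr_ae (Eventually.of_forall fun x => by simp; ring))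

/-- The quadratic form of the Hamiltonian `-½ Δ + v`. -/
def energyForm {v : Space d → ℝ} (hv : MemY v) : H1 d →ₗ[ℝ] H1 d →ₗ[ℝ] ℝ :=
  (1 / 2 : ℝ) • dirichletForm d + potentialForm hv

variable {v : Space d → ℝ}

theorem energyForm_apply (hv : MemY v) (f g : H1 d) : energyForm hv f g
    = (1 / 2) * (∫ x, inner ℝ (weakGradient f.1 x) (weakGradient g.1 x))
      + ∫ x, v x * f.1 x * g.1 x := rfl

theorem energyForm_symm (hv : MemY v) (f g : H1 d) : energyForm hv f g = energyForm hv g f := by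
  simp only [energyForm_apply, real_inner_comm (weakGradient g.1 _), mul_right_comm (v _) (g.1 _)]

theorem energyForm_self (hv : MemY v) (f : H1 d) : energyForm hv f f = energy v f.1 := by
  simp only [energyForm_apply, energy, real_inner_self_eq_norm_sq, mul_assoc, ← sq]

theorem isWeakEigenfunction_iff (hv : MemY v) (ψ : H1 d) (μ : ℝ) :
    IsWeakEigenfunction v ψ.1 μ ↔ ∀ w, energyForm hv ψ w = μ * massForm d ψ w :=
  ⟨fun h w => h w.1 w.2, fun h w hw => h ⟨w, hw⟩⟩

theorem orbitalEnergy_eq {N : ℕ} (hv : MemY v) (Φ : Fin N → H1 d) :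
    orbitalEnergy v (fun i => (Φ i).1) = 2 * ∑ i, energyForm hv (Φ i) (Φ i) := by
  rw [orbitalEnergy, Finset.mul_sum]
  refine Finset.sum_congr rfl fun i _ => ?_
  have h1 : Integrable fun x => ‖weakGradient (Φ i).1 x‖ ^ 2 :=
    (Φ i).2.memLp_weakGradient.integrable_norm_pow two_ne_zero
  have h2 := (hv.integrable_mul_sq (Φ i).2).const_mul 2
  rw [energyForm_self, energy, mul_add, ← mul_assoc, ← integral_const_mul 2 (fun x => v x * _)]
  have e : ∀ x, 2 * (Φ i).1 x ^ 2 * v x = 2 * (v x * (Φ i).1 x ^ 2) := fun x => by ring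
  simp only [e]
  rw [integral_add h1 h2]
  ring

theorem isOrbitalMinimizer_iff {N : ℕ} (hv : MemY v) (Φ : Fin N → H1 d) :
    IsOrbitalMinimizer v (fun i => (Φ i).1) ↔ IsTraceMinimizer (energyForm hv) (massForm d) Φ := by
  constructor
  · rintro ⟨⟨-, h1⟩, h2⟩
    refine ⟨h1, fun Ψ hΨ => ?_⟩
    have := h2 (fun i => (Ψ i).1) ⟨fun i => (Ψ i).2, hΨ⟩
    rw [orbitalEnergy_eq hv, orbitalEnergy_eq hv] at this
    linarith
  · rintro ⟨h1, h2⟩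
    refine ⟨⟨fun i => (Φ i).2, h1⟩, fun Ψ hΨ => ?_⟩
    have := h2 (fun i => ⟨Ψ i, hΨ.1 i⟩) hΨ.2
    have e := orbitalEnergy_eq hv (fun i => (⟨Ψ i, hΨ.1 i⟩ : H1 d))
    rw [orbitalEnergy_eq hv, e]
    linarith

/-! ### Lowest orbitals and ground states -/

/-- A lowest orbital, in terms of the forms. -/
theorem IsLowestOrbital.exists_system {N : ℕ} (hv : MemY v) {f : Space d → ℝ}
    (hf : IsLowestOrbital N v f) : ∃ (ψ : Fin N → H1 d) (μ : Fin N → ℝ),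
      IsTraceMinimizer (energyForm hv) (massForm d) ψ ∧
      (∀ j w, energyForm hv (ψ j) w = μ j * massForm d (ψ j) w) ∧
      ∃ j, (∀ i, μ j ≤ μ i) ∧ f = (ψ j).1 := by
  obtain ⟨ψ, μ, ⟨h1, h2⟩, j, hj, rfl⟩ := hf
  have hm := h1.1.1
  exact ⟨fun i => ⟨ψ i, hm i⟩, μ, (isOrbitalMinimizer_iff hv _).1 h1,
    fun i => (isWeakEigenfunction_iff hv ⟨ψ i, hm i⟩ _).1 (h2 i), j, hj, rfl⟩

theorem isLowestOrbital_of_system {N : ℕ} (hv : MemY v) {ψ : Fin N → H1 d} {μ : Fin N → ℝ}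
    (h : IsTraceMinimizer (energyForm hv) (massForm d) ψ)
    (hμ : ∀ j w, energyForm hv (ψ j) w = μ j * massForm d (ψ j) w) {j : Fin N}
    (hj : ∀ i, μ j ≤ μ i) : IsLowestOrbital N v (ψ j).1 :=
  ⟨fun i => (ψ i).1, μ, ⟨(isOrbitalMinimizer_iff hv _).2 h,
    fun i => (isWeakEigenfunction_iff hv _ _).2 (hμ i)⟩, j, hj, rfl⟩

theorem exists_isLowestOrbital {N : ℕ} (hN : 1 ≤ N) (hvW : v ∈ W d N) :
    ∃ f, IsLowestOrbital N v f := by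
  obtain ⟨hv, Φ, hΦ⟩ := hvW
  have h0 := (isOrbitalMinimizer_iff hv fun i => (⟨Φ i, hΦ.1.1 i⟩ : H1 d)).1 hΦ
  obtain ⟨χ, μ, hχ, hμ⟩ := h0.exists_diagonal (energyForm_symm hv)
  have : Nonempty (Fin N) := ⟨⟨0, hN⟩⟩
  obtain ⟨j, hj⟩ := Finite.exists_min μ
  exact ⟨_, isLowestOrbital_of_system hv hχ
    (hχ.apply_eq massForm_symm massForm_nonneg (energyForm_symm hv) hμ) hj⟩

/-- On normalized functions `lowest_mul_le` bounds the energy below by `μ j`, which is the energy of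
`ψ j`. -/
theorem IsLowestOrbital.isEnergyMinimizer {N : ℕ} (hv : MemY v) {f : Space d → ℝ}
    (hf : IsLowestOrbital N v f) : IsEnergyMinimizer v f := by
  obtain ⟨ψ, μ, h, hμ, j, hj, rfl⟩ := hf.exists_system hv
  have h1 : massForm d (ψ j) (ψ j) = 1 := by rw [h.1 j j]; simp
  refine ⟨⟨(ψ j).2, by rw [← massForm_self, h1]⟩, fun g hg hg1 => ?_⟩
  have := h.lowest_mul_le massForm_symm massForm_nonneg (energyForm_symm hv) hμ hj ⟨g, hg⟩
  rw [massForm_self, hg1, energyForm_self] at this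
  rw [← energyForm_self hv, hμ, h1]
  exact this

/-- The ground state energy and the variational characterization of its eigenfunctions. -/
theorem exists_groundEnergy {N : ℕ} (hN : 1 ≤ N) (hvW : v ∈ W d N) (hv : MemY v) :
    ∃ lam : ℝ, (∀ f : H1 d, lam * massForm d f f ≤ energyForm hv f f) ∧
      (∀ f, IsEnergyMinimizer v f → energy v f = lam) ∧
      ∀ f : H1 d, massForm d f f = 1 → (∀ w, energyForm hv f w = lam * massForm d f w) →
        IsEnergyMinimizer v f.1 ∧ IsLowestOrbital N v f.1 := by
  obtain ⟨f₀, hf₀⟩ := exists_isLowestOrbital hN hvW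
  have hmin := hf₀.isEnergyMinimizer hv
  obtain ⟨ψ, μ, h, hμ, j, hj, rfl⟩ := hf₀.exists_system hv
  have hE : energy v (ψ j).1 = μ j := by
    rw [← energyForm_self hv, hμ, h.1 j j]; simp
  refine ⟨μ j, h.lowest_mul_le massForm_symm massForm_nonneg (energyForm_symm hv) hμ hj,
    fun f hf => ?_, fun f hf1 hf => ?_⟩
  · rw [← hE]
    exact le_antisymm (hf.2 _ hmin.1.1 hmin.1.2) (hmin.2 _ hf.1.1 hf.1.2)
  · obtain ⟨χ, hχ, hχμ, rfl⟩ :=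
      h.exists_apply_eq massForm_symm massForm_nonneg (energyForm_symm hv) hμ hf1 hf
    have := isLowestOrbital_of_system hv hχ hχμ hj
    exact ⟨this.isEnergyMinimizer hv, this⟩

/-- A vector attaining the bottom of the form is an eigenvector. -/
theorem energyForm_apply_eq {hv : MemY v} {lam : ℝ}
    (hlam : ∀ f : H1 d, lam * massForm d f f ≤ energyForm hv f f) {f : H1 d}
    (hf : energyForm hv f f ≤ lam * massForm d f f) (w : H1 d) :
    energyForm hv f w = lam * massForm d f w := by
  have := apply_eq_zero_of_apply_self_eq_zero (q := energyForm hv - lam • massForm d)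
    (fun x y => by simp [energyForm_symm hv x, massForm_symm x])
    (fun x => by simpa using hlam x) (f := f)
    (by simpa [sub_eq_zero] using le_antisymm hf (hlam f)) w
  simpa [sub_eq_zero] using this

/-- The potential term depends only on `f²`, and `‖∇|f|‖ ≤ ‖∇f‖` almost everywhere. -/
theorem energy_abs_le {f : Space d → ℝ} (hf : MemH1 f) : energy v (fun x => |f x|) ≤ energy v f := by
  simp only [energy, sq_abs]
  gcongr ?_ * ?_ + _
  refine integral_mono_ae (hf.abs.memLp_weakGradient.integrable_norm_pow two_ne_zero)
    (hf.memLp_weakGradient.integrable_norm_pow two_ne_zero) ?_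
  filter_upwards [hf.norm_weakGradient_abs_le] with x hx
  gcongr

/-- The absolute value of a lowest eigenfunction is a lowest eigenfunction. -/
theorem energyForm_abs_apply_eq {hv : MemY v} {lam : ℝ}
    (hlam : ∀ f : H1 d, lam * massForm d f f ≤ energyForm hv f f) {f : H1 d}
    (hf : ∀ w, energyForm hv f w = lam * massForm d f w) (w : H1 d) :
    energyForm hv ⟨_, f.2.abs⟩ w = lam * massForm d ⟨_, f.2.abs⟩ w := by
  refine energyForm_apply_eq hlam ?_ w
  have h1 : massForm d ⟨_, f.2.abs⟩ ⟨_, f.2.abs⟩ = massForm d f f := by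
    simp only [massForm_self, sq_abs]
  rw [h1, ← hf, energyForm_self, energyForm_self]
  exact energy_abs_le f.2

/-- A minimizer attains the bottom of the form, so it and its modulus are eigenvectors there; the
reflection argument behind `exists_groundEnergy` then makes the modulus a member of a Kohn–Sham
system. -/
theorem IsEnergyMinimizer.abs {N : ℕ} (hN : 1 ≤ N) (hvW : v ∈ W d N) {f : Space d → ℝ}
    (hf : IsEnergyMinimizer v f) :
    IsEnergyMinimizer v (fun x => |f x|) ∧ IsLowestOrbital N v (fun x => |f x|) := by
  have hv := hvW.1
  obtain ⟨lam, hlam, hE, hlow⟩ := exists_groundEnergy hN hvW hv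
  have h1 : ∫ x, |f x| ^ 2 = 1 := by simpa only [sq_abs] using hf.1.2
  refine hlow ⟨_, hf.1.1.abs⟩ (by rw [massForm_self, h1])
    (energyForm_abs_apply_eq hlam (f := ⟨f, hf.1.1⟩) (energyForm_apply_eq hlam ?_))
  have h2 : massForm d ⟨f, hf.1.1⟩ ⟨f, hf.1.1⟩ = 1 := (massForm_self _).trans hf.1.2
  rw [energyForm_self, h2, mul_one]
  exact (hE f hf).le

/-! ### Logarithmic gradient estimate and strong maximum principle -/

/-- A function with vanishing weak gradient is constant. -/
theorem HasWeakGradient.exists_ae_eq_const {f : Space d → ℝ}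
    (h : HasWeakGradient f (0 : Space d → Space d)) : ∃ c : ℝ, ∀ᵐ x, f x = c := by
  let F : ℕ → Space d → ℝ := fun n => (mollifier d n).normed volume
    ⋆[ContinuousLinearMap.lsmul ℝ ℝ, volume] f
  have hconst : ∀ n x y, F n x = F n y := fun n => by
    have hs : ContDiff ℝ ∞ (F n) :=
      ((mollifier d n).hasCompactSupport_normed (μ := volume)).contDiff_convolution_left
        _ (mollifier d n).contDiff_normed h.1
    refine is_const_of_fderiv_eq_zero (𝕜 := ℝ) (hs.differentiable (by simp)) fun x => ?_
    have h1 := h.gradient_convolution ((mollifier d n).contDiff_normed (μ := volume))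
      (mollifier d n).hasCompactSupport_normed x
    rw [convolution_zero] at h1
    ext y
    rw [← inner_gradient, h1]
    simp
  have hae := ae_tendsto_mollifier h.1
  obtain ⟨x₀, hx₀⟩ := hae.exists
  refine ⟨f x₀, ?_⟩
  filter_upwards [hae] with x hx
  exact tendsto_nhds_unique (hx.congr fun n => hconst n x x₀) hx₀

/-- The profile `s ↦ (√(s² + ε²) - s) / ε²`, a regularization of `1 / (2 s)`. -/
def recipProfile (ε s : ℝ) : ℝ := (√(s ^ 2 + ε ^ 2) - s) / ε ^ 2

/-- By conjugation the profile equals `1 / (√(s² + ε²) + s)`, the source of all its bounds. Unlike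
`1 / (s + ε)` it is smooth on the whole line with bounded derivative, as the chain rule requires. -/
theorem recipProfile_mul {ε : ℝ} (hε : 0 < ε) (s : ℝ) :
    recipProfile ε s * (√(s ^ 2 + ε ^ 2) + s) = 1 := by
  have h := Real.sq_sqrt (sq_add_sq_pos hε s).le
  rw [recipProfile, div_mul_eq_mul_div, div_eq_one_iff_eq (by positivity)]
  linear_combination h

theorem hasDerivAt_recipProfile {ε : ℝ} (hε : 0 < ε) (s : ℝ) :
    HasDerivAt (recipProfile ε) ((s / √(s ^ 2 + ε ^ 2) - 1) / ε ^ 2) s :=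
  ((hasDerivAt_sqrt_sq_add_sq hε s).sub (hasDerivAt_id s)).div_const _

theorem recipProfile_deriv_eq {ε : ℝ} (hε : 0 < ε) (s : ℝ) :
    (s / √(s ^ 2 + ε ^ 2) - 1) / ε ^ 2 = -(recipProfile ε s / √(s ^ 2 + ε ^ 2)) := by
  have := Real.sqrt_pos.2 (sq_add_sq_pos hε s)
  rw [recipProfile]
  field_simp
  ring

theorem continuous_div_sqrt_sq_add_sq {ε : ℝ} (hε : 0 < ε) :
    Continuous fun s : ℝ => s / √(s ^ 2 + ε ^ 2) :=
  continuous_id.div (continuous_sqrt_sq_add_sq _)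
    fun s => (Real.sqrt_pos.2 (sq_add_sq_pos hε s)).ne'

theorem recipProfile_deriv_le {ε : ℝ} (hε : 0 < ε) (s : ℝ) :
    |(s / √(s ^ 2 + ε ^ 2) - 1) / ε ^ 2| ≤ 2 / ε ^ 2 := by
  rw [abs_div, abs_of_pos (by positivity : 0 < ε ^ 2)]
  gcongr
  have := abs_div_sqrt_sq_add_sq_le hε s
  rw [abs_le] at *
  constructor <;> linarith

/-- Bounds for the profile on the positive half line. -/
theorem recipProfile_bounds {ε s : ℝ} (hε : 0 < ε) (hs : 0 ≤ s) :
    0 < recipProfile ε s ∧ recipProfile ε s * √(s ^ 2 + ε ^ 2) ≤ 1 ∧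
      1 ≤ 2 * (recipProfile ε s * √(s ^ 2 + ε ^ 2)) ∧ s * recipProfile ε s ≤ 1 ∧
      recipProfile ε s ≤ 1 / ε := by
  have h1 := recipProfile_mul hε s
  have h2 := Real.sqrt_pos.2 (sq_add_sq_pos hε s)
  have h3 : s ≤ √(s ^ 2 + ε ^ 2) := (le_abs_self s).trans (abs_le_sqrt_sq_add_sq ε s)
  have h4 : ε ≤ √(s ^ 2 + ε ^ 2) := Real.le_sqrt_of_sq_le (by nlinarith)
  have h0 : 0 < recipProfile ε s := by
    by_contra h
    nlinarith [not_lt.1 h]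
  refine ⟨h0, by nlinarith, by nlinarith, by nlinarith, ?_⟩
  rw [le_div_iff₀ hε]
  nlinarith

theorem gradient_sq {φ : Space d → ℝ} (hφ : ContDiff ℝ 1 φ) (x : Space d) :
    gradient (fun x => φ x * φ x) x = (2 * φ x) • gradient φ x := by
  rw [gradient_mul (hφ.differentiable one_ne_zero x) (hφ.differentiable one_ne_zero x), ← add_smul,
    two_mul]

/-- The test function `φ² F(u)`. -/
theorem MemH1.sq_mul_recipProfile {u : Space d → ℝ} (hu : MemH1 u) (h0 : ∀ x, 0 ≤ u x) {ε : ℝ}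
    (hε : 0 < ε) {φ : Space d → ℝ} (hφ : ContDiff ℝ ∞ φ) (hc : HasCompactSupport φ) :
    MemH1 (fun x => φ x * φ x * recipProfile ε (u x)) ∧
      weakGradient (fun x => φ x * φ x * recipProfile ε (u x)) =ᵐ[volume] fun x =>
        (φ x * φ x) • (((u x / √(u x ^ 2 + ε ^ 2) - 1) / ε ^ 2) • weakGradient u x)
          + recipProfile ε (u x) • ((2 * φ x) • gradient φ x) := by
  have hφ1 : ContDiff ℝ 1 φ := hφ.of_le (by exact_mod_cast le_top)
  have hcF' : Continuous fun s : ℝ => (s / √(s ^ 2 + ε ^ 2) - 1) / ε ^ 2 :=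
    ((continuous_div_sqrt_sq_add_sq hε).sub continuous_const).div_const _
  have hF : Continuous (recipProfile ε) :=
    ((continuous_sqrt_sq_add_sq ε).sub continuous_id).div_const _
  have hFu : AEStronglyMeasurable (fun x => recipProfile ε (u x)) volume :=
    hF.comp_aestronglyMeasurable hu.1.1
  have hw := (hu.hasWeakGradient.comp hu.1 hu.memLp_weakGradient (hasDerivAt_recipProfile hε)
    hcF' (recipProfile_deriv_le hε)).smooth_mul (hφ.mul hφ)
  simp only [gradient_sq hφ1] at hw
  have hFb : ∀ x, ‖recipProfile ε (u x)‖ ≤ 1 / ε := fun x => by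
    have := recipProfile_bounds hε (h0 x)
    rw [Real.norm_of_nonneg this.1.le]; exact this.2.2.2.2
  have hφφ : MemLp (fun x => φ x * φ x) 2 volume :=
    (hφ.continuous.mul hφ.continuous).memLp_of_hasCompactSupport hc.mul_left
  have hφg : MemLp (fun x => (2 * φ x) • gradient φ x) 2 volume :=
    ((continuous_const.mul hφ.continuous).smul
      (continuous_gradient hφ1)).memLp_of_hasCompactSupport hc.mul_left.smul_right
  refine ⟨⟨?_, _, ?_, hw⟩, weakGradient_ae_eq hw⟩
  · refine (hφφ.const_mul (1 / ε)).mono (hφφ.1.mul hFu) (Eventually.of_forall fun x => ?_)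
    rw [norm_mul, norm_mul (1 / ε), Real.norm_of_nonneg (by positivity : 0 ≤ 1 / ε), mul_comm]
    exact mul_le_mul_of_nonneg_right (hFb x) (norm_nonneg _)
  · obtain ⟨C, hC⟩ := (hc.mul_left (f := φ)).exists_bound_of_continuous
      (hφ.continuous.mul hφ.continuous)
    refine MemLp.add ?_ ?_
    · refine (hu.memLp_weakGradient.const_smul (C * (2 / ε ^ 2))).mono
        (hφφ.1.smul ((hcF'.comp_aestronglyMeasurable hu.1.1).smul hu.memLp_weakGradient.1))
        (Eventually.of_forall fun x => ?_)
      have hCx : ‖φ x * φ x‖ ≤ C := hC x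
      have hC0 : 0 ≤ C := (norm_nonneg _).trans hCx
      rw [norm_smul, norm_smul, Pi.smul_apply, norm_smul, Real.norm_of_nonneg (by positivity :
        0 ≤ C * (2 / ε ^ 2)), ← mul_assoc]
      gcongr
      exact recipProfile_deriv_le hε _
    · refine (hφg.const_smul (1 / ε)).mono (hFu.smul hφg.1) (Eventually.of_forall fun x => ?_)
      rw [norm_smul, Pi.smul_apply, norm_smul (1 / ε), Real.norm_of_nonneg (by positivity : 0 ≤ 1 / ε)]
      exact mul_le_mul_of_nonneg_right (hFb x) (norm_nonneg _)

/-- Logarithmic Caccioppoli estimate for nonnegative eigenfunctions, uniform in `ε`. -/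
theorem exists_caccioppoli_bound {hv : MemY v} (hvb : MemLp v ⊤ volume) {u : H1 d}
    (h0 : ∀ x, 0 ≤ u.1 x) {lam : ℝ} (hu : ∀ w, energyForm hv u w = lam * massForm d u w)
    {φ : Space d → ℝ} (hφ : ContDiff ℝ ∞ φ) (hc : HasCompactSupport φ) :
    ∃ K : ℝ, ∀ ε : ℝ, 0 < ε →
      Integrable (fun x => φ x ^ 2 * ‖weakGradient u.1 x‖ ^ 2 / (u.1 x ^ 2 + ε ^ 2)) ∧
      ∫ x, φ x ^ 2 * ‖weakGradient u.1 x‖ ^ 2 / (u.1 x ^ 2 + ε ^ 2) ≤ K := by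
  have hφ1 : ContDiff ℝ 1 φ := hφ.of_le (by exact_mod_cast le_top)
  obtain ⟨V, hV⟩ : ∃ V : ℝ, ∀ᵐ x, |v x| ≤ V := by
    refine ⟨(eLpNorm v ⊤ volume).toReal, ?_⟩
    filter_upwards [ae_le_eLpNormEssSup (f := v) (μ := (volume : Measure (Space d)))] with x hx
    rw [← eLpNorm_exponent_top] at hx
    have := ENNReal.toReal_mono hvb.eLpNorm_ne_top hx
    simpa using this
  have iφ : Integrable fun x => φ x ^ 2 :=
    (hφ.continuous.memLp_of_hasCompactSupport hc (p := 2)).integrable_sq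
  have iG : Integrable fun x => ‖gradient φ x‖ ^ 2 :=
    ((continuous_gradient hφ1).memLp_of_hasCompactSupport
      (hasCompactSupport_gradient hc) (p := 2)).integrable_norm_pow two_ne_zero
  -- The integrand is at most `4 (-∇u · ∇w + 2 ‖∇φ‖²)` for `w = φ² F(u)`, with `F` the profile, and
  -- the equation gives `-∫ ∇u · ∇w = 2 ∫ (v - lam) u w ≤ 2 (V + |lam|) ∫ φ²`.
  refine ⟨4 * (2 * ((V + |lam|) * ∫ x, φ x ^ 2) + 2 * ∫ x, ‖gradient φ x‖ ^ 2), fun ε hε => ?_⟩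
  obtain ⟨hw, hwg⟩ := u.2.sq_mul_recipProfile h0 hε hφ hc
  set w : H1 d := ⟨_, hw⟩ with hwdef
  have hg2 : Integrable fun x => ‖weakGradient u.1 x‖ ^ 2 :=
    u.2.memLp_weakGradient.integrable_norm_pow two_ne_zero
  have iQ : Integrable fun x =>
      φ x ^ 2 * ‖weakGradient u.1 x‖ ^ 2 / (u.1 x ^ 2 + ε ^ 2) := by
    obtain ⟨C, hC⟩ := hc.exists_bound_of_continuous hφ.continuous
    have hm : AEStronglyMeasurable (fun x => φ x ^ 2 * ‖weakGradient u.1 x‖ ^ 2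
        / (u.1 x ^ 2 + ε ^ 2)) volume := by
      have h1 := ((iφ.1.mul hg2.1).aemeasurable).div
        ((u.2.1.1.aemeasurable.pow_const 2).add_const (ε ^ 2))
      exact h1.aestronglyMeasurable
    refine (hg2.const_mul (C ^ 2 / ε ^ 2)).mono' hm (Eventually.of_forall fun x => ?_)
    have hp := sq_add_sq_pos hε (u.1 x)
    have h2 : φ x ^ 2 ≤ C ^ 2 := by
      rw [← sq_abs]; have := hC x; rw [Real.norm_eq_abs] at this; gcongr
    rw [Real.norm_of_nonneg (by positivity), mul_div_right_comm]
    gcongr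
    nlinarith [sq_nonneg (u.1 x)]
  refine ⟨iQ, ?_⟩
  have hpt : ∀ᵐ x, φ x ^ 2 * ‖weakGradient u.1 x‖ ^ 2 / (u.1 x ^ 2 + ε ^ 2) ≤
      4 * (-(inner ℝ (weakGradient u.1 x) (weakGradient w.1 x)) + 2 * ‖gradient φ x‖ ^ 2) := by
    filter_upwards [hwg] with x hx
    obtain ⟨hF0, hF1, hF2, -, -⟩ := recipProfile_bounds hε (h0 x)
    have hr := Real.sqrt_pos.2 (sq_add_sq_pos hε (u.1 x))
    have hr2 := Real.sq_sqrt (sq_add_sq_pos hε (u.1 x)).le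
    have hi : inner ℝ (weakGradient u.1 x) (weakGradient w.1 x)
        = -(φ x ^ 2 * (recipProfile ε (u.1 x) / √(u.1 x ^ 2 + ε ^ 2)) * ‖weakGradient u.1 x‖ ^ 2)
          + 2 * φ x * recipProfile ε (u.1 x) * inner ℝ (weakGradient u.1 x) (gradient φ x) := by
      rw [hwdef, hx]
      simp only [inner_add_right, inner_smul_right, recipProfile_deriv_eq hε,
        real_inner_self_eq_norm_sq]
      ring
    rw [hi]
    set r := √(u.1 x ^ 2 + ε ^ 2)
    set F := recipProfile ε (u.1 x)
    set G := ‖weakGradient u.1 x‖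
    have hcs := abs_real_inner_le_norm (weakGradient u.1 x) (gradient φ x)
    set I : ℝ := inner ℝ (weakGradient u.1 x) (gradient φ x)
    set D := ‖gradient φ x‖
    have hFr : F ^ 2 ≤ F / r := by
      rw [le_div_iff₀ hr]; nlinarith
    have hlow : 1 / (u.1 x ^ 2 + ε ^ 2) ≤ 2 * (F / r) := by
      rw [← hr2, ← mul_div_assoc, div_le_div_iff₀ (by positivity) hr]
      nlinarith
    have hD : 0 ≤ D := norm_nonneg _
    have hG : 0 ≤ G := norm_nonneg _
    -- Weighted Young inequality: the cross term costs at most half of the good term `φ² (F / r)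
    -- G²`, because `F² ≤ F / r`.
    have h1 : -(2 * φ x * F * I) ≥ -(φ x ^ 2 * F ^ 2 * G ^ 2 / 2 + 2 * D ^ 2) := by
      have : |φ x * F * I| ≤ |φ x * F| * G * D := by
        rw [abs_mul, mul_assoc |φ x * F|]
        gcongr
      have h3 := le_abs_self (φ x * F * I)
      have h4 : |φ x * F| ^ 2 = φ x ^ 2 * F ^ 2 := by rw [sq_abs]; ring
      nlinarith [sq_nonneg (|φ x * F| * G - 2 * D)]
    have h2 : φ x ^ 2 * F ^ 2 * G ^ 2 ≤ φ x ^ 2 * (F / r) * G ^ 2 := by gcongr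
    have h3 : φ x ^ 2 * G ^ 2 / (u.1 x ^ 2 + ε ^ 2) ≤ 2 * (φ x ^ 2 * (F / r) * G ^ 2) := by
      have : φ x ^ 2 * G ^ 2 / (u.1 x ^ 2 + ε ^ 2)
          = φ x ^ 2 * G ^ 2 * (1 / (u.1 x ^ 2 + ε ^ 2)) := by ring
      rw [this]
      have := mul_le_mul_of_nonneg_left hlow (by positivity : 0 ≤ φ x ^ 2 * G ^ 2)
      linarith
    linarith
  have iI := u.2.integrable_inner w.2
  have hint := integral_mono_ae iQ ((iI.neg.add (iG.const_mul 2)).const_mul 4) hpt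
  have hrhs : ∫ x, 4 * (-(inner ℝ (weakGradient u.1 x) (weakGradient w.1 x))
      + 2 * ‖gradient φ x‖ ^ 2) = 4 * (-(∫ x, inner ℝ (weakGradient u.1 x) (weakGradient w.1 x))
      + 2 * ∫ x, ‖gradient φ x‖ ^ 2) := by
    have iN : Integrable fun x => -(inner ℝ (weakGradient u.1 x) (weakGradient w.1 x) : ℝ) := iI.neg
    rw [integral_const_mul, integral_add iN (iG.const_mul 2), integral_neg, integral_const_mul]
  refine hint.trans ((le_of_eq hrhs).trans ?_)
  have heq := hu w
  rw [energyForm_apply, massForm_apply] at heq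
  have iv := hv.integrable_mul_mul u.2 w.2
  have im := u.2.integrable_mul w.2
  -- Here boundedness of `v` enters. The factor `u` cancels the singularity of the test function, `0
  -- ≤ u w ≤ φ²`, so the bound does not depend on `ε`.
  have hle : (∫ x, v x * u.1 x * w.1 x) - lam * ∫ x, u.1 x * w.1 x
      ≤ (V + |lam|) * ∫ x, φ x ^ 2 := by
    rw [← integral_const_mul, ← integral_sub iv (im.const_mul lam), ← integral_const_mul]
    refine integral_mono_ae (iv.sub (im.const_mul lam)) (iφ.const_mul _) ?_
    filter_upwards [hV] with x hx
    obtain ⟨hF0, -, -, hF3, -⟩ := recipProfile_bounds hε (h0 x)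
    have h1 : u.1 x * w.1 x = φ x ^ 2 * (u.1 x * recipProfile ε (u.1 x)) := by
      simp only [hwdef]; ring
    have h2 : 0 ≤ u.1 x * w.1 x := by rw [h1]; have := h0 x; positivity
    have h3 : u.1 x * w.1 x ≤ φ x ^ 2 := by
      rw [h1]; exact mul_le_of_le_one_right (sq_nonneg _) hF3
    have h4 : v x - lam ≤ V + |lam| := by
      have := le_abs_self (v x); have := neg_abs_le lam; linarith
    have h5 : 0 ≤ V + |lam| := add_nonneg ((abs_nonneg _).trans hx) (abs_nonneg _)
    calc v x * u.1 x * w.1 x - lam * (u.1 x * w.1 x) = (v x - lam) * (u.1 x * w.1 x) := by ring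
      _ ≤ (V + |lam|) * (u.1 x * w.1 x) := by gcongr
      _ ≤ (V + |lam|) * φ x ^ 2 := by gcongr
  linarith

/-- The logarithmic gradient of a nonnegative eigenfunction is locally integrable. -/
theorem locallyIntegrable_norm_weakGradient_div {hv : MemY v} (hvb : MemLp v ⊤ volume) {u : H1 d}
    (h0 : ∀ x, 0 ≤ u.1 x) {lam : ℝ} (hu : ∀ w, energyForm hv u w = lam * massForm d u w) :
    LocallyIntegrable (fun x => ‖weakGradient u.1 x‖ / u.1 x) volume := by
  obtain ⟨χ, -, hχs, hχc, -, hχ1, -⟩ := exists_cutoff d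
  have hm : AEStronglyMeasurable (fun x => ‖weakGradient u.1 x‖ / u.1 x) volume :=
    (u.2.memLp_weakGradient.1.norm.aemeasurable.div u.2.1.1.aemeasurable).aestronglyMeasurable
  have key : ∀ n, Integrable fun x => χ n x ^ 2 * ‖weakGradient u.1 x‖ ^ 2 / u.1 x ^ 2 := by
    intro n
    obtain ⟨K, hK⟩ := exists_caccioppoli_bound hvb h0 hu (hχs n) (hχc n)
    have hpos : ∀ m : ℕ, (0 : ℝ) < 1 / ((m : ℝ) + 1) := fun m => by positivity
    have hlim : ∀ᵐ x, Tendsto (fun m : ℕ => χ n x ^ 2 * ‖weakGradient u.1 x‖ ^ 2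
        / (u.1 x ^ 2 + (1 / ((m : ℝ) + 1)) ^ 2)) atTop
        (𝓝 (χ n x ^ 2 * ‖weakGradient u.1 x‖ ^ 2 / u.1 x ^ 2)) := by
      filter_upwards [u.2.weakGradient_eq_zero_of_nonneg h0] with x hx
      -- Where `u` vanishes so does its gradient, and the limit is `0 / 0 = 0`.
      rcases eq_or_ne (u.1 x) 0 with h | h
      · simp [hx h]
      · have h1 := ((tendsto_one_div_add_atTop_nhds_zero_nat (𝕜 := ℝ)).pow 2).const_add (u.1 x ^ 2)
        rw [zero_pow two_ne_zero, add_zero] at h1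
        exact tendsto_const_nhds.div h1 (pow_ne_zero 2 h)
    have hb : eLpNorm (fun x => χ n x ^ 2 * ‖weakGradient u.1 x‖ ^ 2 / u.1 x ^ 2) 1 volume
        ≤ ENNReal.ofReal K := by
      refine Lp.eLpNorm_le_of_ae_tendsto (Eventually.of_forall fun m => ?_)
        (fun m => (hK _ (hpos m)).1.1) hlim
      have hnn : ∀ x, 0 ≤ χ n x ^ 2 * ‖weakGradient u.1 x‖ ^ 2
          / (u.1 x ^ 2 + (1 / ((m : ℝ) + 1)) ^ 2) := fun x => by positivity
      rw [eLpNorm_one_eq_lintegral_enorm]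
      simp only [fun x => Real.enorm_of_nonneg (hnn x)]
      rw [← ofReal_integral_eq_lintegral_ofReal (hK _ (hpos m)).1 (Eventually.of_forall hnn)]
      exact ENNReal.ofReal_le_ofReal (hK _ (hpos m)).2
    exact memLp_one_iff_integrable.1 ⟨aestronglyMeasurable_of_tendsto_ae atTop
      (fun m => (hK _ (hpos m)).1.1) hlim, hb.trans_lt ENNReal.ofReal_lt_top⟩
  rw [locallyIntegrable_iff]
  intro S hS
  obtain ⟨R, hR⟩ := hS.isBounded.exists_norm_le
  obtain ⟨n, hn⟩ := exists_nat_ge R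
  refine (((key n).integrableOn (s := S)).add (integrableOn_const hS.measure_lt_top.ne
    (C := (1 : ℝ)))).mono' hm.restrict ?_
  filter_upwards [ae_restrict_mem hS.measurableSet] with x hx
  have h1 : χ n x = 1 := hχ1 n x ((hR x hx).trans (by linarith))
  rw [Pi.add_apply, h1, one_pow, one_mul, ← div_pow,
    Real.norm_of_nonneg (div_nonneg (norm_nonneg _) (h0 x))]
  -- The elementary bound `t ≤ t² + 1` for the logarithmic gradient `t`.
  nlinarith [sq_nonneg (‖weakGradient u.1 x‖ / u.1 x - 1 / 2)]

theorem hasDerivAt_div_sqrt_sq_add_sq {ε : ℝ} (hε : 0 < ε) (s : ℝ) :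
    HasDerivAt (fun s => s / √(s ^ 2 + ε ^ 2)) (ε ^ 2 / ((s ^ 2 + ε ^ 2) * √(s ^ 2 + ε ^ 2))) s := by
  have hr := Real.sqrt_pos.2 (sq_add_sq_pos hε s)
  have hr2 := Real.sq_sqrt (sq_add_sq_pos hε s).le
  have h := (hasDerivAt_id s).div (hasDerivAt_sqrt_sq_add_sq hε s) hr.ne'
  refine h.congr_deriv ?_
  have hp := sq_add_sq_pos hε s
  simp only [id, hr2]
  field_simp
  rw [hr2]
  ring

/-- Strong maximum principle: a nonnegative eigenfunction vanishes identically or is positive. -/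
theorem ae_eq_zero_or_ae_pos {hv : MemY v} (hvb : MemLp v ⊤ volume) {u : H1 d}
    (h0 : ∀ x, 0 ≤ u.1 x) {lam : ℝ} (hu : ∀ w, energyForm hv u w = lam * massForm d u w) :
    (∀ᵐ x, u.1 x = 0) ∨ ∀ᵐ x, 0 < u.1 x := by
  have hpos : ∀ n : ℕ, (0 : ℝ) < 1 / ((n : ℝ) + 1) := fun n => by positivity
  have hgrad := u.2.weakGradient_eq_zero_of_nonneg h0
  let H' : ℕ → ℝ → ℝ := fun n s => (1 / ((n : ℝ) + 1)) ^ 2 /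
    ((s ^ 2 + (1 / ((n : ℝ) + 1)) ^ 2) * √(s ^ 2 + (1 / ((n : ℝ) + 1)) ^ 2))
  have hH'c : ∀ n, Continuous (H' n) := fun n => by
    refine continuous_const.div (by fun_prop) fun s => ?_
    have := Real.sqrt_pos.2 (sq_add_sq_pos (hpos n) s)
    have := sq_add_sq_pos (hpos n) s
    positivity
  have hH'0 : ∀ n s, 0 ≤ H' n s := fun n s => by positivity
  have hH'sqrt : ∀ n s, H' n s * √(s ^ 2 + (1 / ((n : ℝ) + 1)) ^ 2) ≤ 1 := fun n s => by
    have h1 := Real.sqrt_pos.2 (sq_add_sq_pos (hpos n) s)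
    have h2 := sq_add_sq_pos (hpos n) s
    simp only [H']
    rw [div_mul_eq_mul_div, mul_div_mul_right _ _ h1.ne', div_le_one h2]
    nlinarith [sq_nonneg s]
  have hH'b : ∀ n s, |H' n s| ≤ (n : ℝ) + 1 := fun n s => by
    rw [abs_of_nonneg (hH'0 n s)]
    have h2 : 1 / ((n : ℝ) + 1) ≤ √(s ^ 2 + (1 / ((n : ℝ) + 1)) ^ 2) :=
      Real.le_sqrt_of_sq_le (by nlinarith [sq_nonneg s])
    have h3 := (mul_le_mul_of_nonneg_left h2 (hH'0 n s)).trans (hH'sqrt n s)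
    rwa [mul_one_div, div_le_one (by positivity)] at h3
  have hn : ∀ n : ℕ, HasWeakGradient
      (fun x => u.1 x / √(u.1 x ^ 2 + (1 / ((n : ℝ) + 1)) ^ 2))
      (fun x => H' n (u.1 x) • weakGradient u.1 x) := fun n =>
    u.2.hasWeakGradient.comp u.2.1 u.2.memLp_weakGradient
      (fun s => hasDerivAt_div_sqrt_sq_add_sq (hpos n) s) (hH'c n) (hH'b n)
  have hsm : AEStronglyMeasurable (fun x => (SignType.sign (u.1 x) : ℝ)) volume :=
    aestronglyMeasurable_of_tendsto_ae atTop (fun n => (hn n).1.aestronglyMeasurable)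
      (Eventually.of_forall fun x => tendsto_div_sqrt_sq_add_sq (u.1 x))
  -- The gradients `H' n (u) ∇u` tend to zero, and `s * H' n s ≤ 1` for `s ≥ 0` dominates them by
  -- the locally integrable `‖∇u‖ / u`, uniformly in `n`.
  have hsign : HasWeakGradient (fun x => (SignType.sign (u.1 x) : ℝ)) (0 : Space d → Space d) := by
    refine .of_dominated hn ?_ locallyIntegrable_zero (locallyIntegrable_const 1)
      (locallyIntegrable_norm_weakGradient_div hvb h0 hu) (fun n => ?_) (fun n => ?_)
      (Eventually.of_forall fun x => tendsto_div_sqrt_sq_add_sq (u.1 x)) ?_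
    · refine (locallyIntegrable_const (1 : ℝ)).mono hsm (Eventually.of_forall fun x => ?_)
      rcases lt_trichotomy (u.1 x) 0 with hs | hs | hs <;> simp [hs]
    · exact Eventually.of_forall fun x => abs_div_sqrt_sq_add_sq_le (hpos n) _
    · filter_upwards [hgrad] with x hx
      rcases (h0 x).eq_or_lt with h | h
      · simp [hx h.symm]
      · rw [norm_smul, Real.norm_of_nonneg (hH'0 n _), le_div_iff₀ h, mul_right_comm]
        refine mul_le_of_le_one_left (norm_nonneg _) (le_trans ?_ (hH'sqrt n (u.1 x)))
        exact mul_le_mul_of_nonneg_left ((le_abs_self _).trans (abs_le_sqrt_sq_add_sq _ _))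
          (hH'0 n _)
    · filter_upwards [hgrad] with x hx
      rcases (h0 x).eq_or_lt with h | h
      · simp [hx h.symm]
      · have h1 := (tendsto_one_div_add_atTop_nhds_zero_nat (𝕜 := ℝ)).pow 2
        have h2 := h1.const_add (u.1 x ^ 2)
        have h3 := h1.div (h2.mul h2.sqrt) (by positivity)
        rw [zero_pow two_ne_zero, zero_div] at h3
        have h4 : Tendsto (fun n => H' n (u.1 x)) atTop (𝓝 0) := h3
        simpa using h4.smul_const (weakGradient u.1 x)
  obtain ⟨c, hc⟩ := hsign.exists_ae_eq_const
  by_cases hc1 : c = 1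
  · right
    filter_upwards [hc] with x hx
    by_contra h
    rw [le_antisymm (not_lt.1 h) (h0 x), hc1] at hx
    simp at hx
  · left
    filter_upwards [hc] with x hx
    by_contra h
    rw [sign_pos (lt_of_le_of_ne (h0 x) (Ne.symm h))] at hx
    exact hc1 (by simpa using hx.symm)

/-! ### Sign and uniqueness of the ground state -/

/-- Eigenfunctions of the lowest eigenvalue have a strict sign, unless they vanish. -/
theorem ae_zero_or_pos_or_neg {hv : MemY v} (hvb : MemLp v ⊤ volume) {lam : ℝ}
    (hlam : ∀ f : H1 d, lam * massForm d f f ≤ energyForm hv f f) {f : H1 d}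
    (hf : ∀ w, energyForm hv f w = lam * massForm d f w) :
    (∀ᵐ x, f.1 x = 0) ∨ (∀ᵐ x, 0 < f.1 x) ∨ ∀ᵐ x, f.1 x < 0 := by
  have habs := energyForm_abs_apply_eq hlam hf
  -- `|f| - f` is a nonnegative eigenfunction for the same eigenvalue. If it vanishes then `f =
  -- |f|`; if it is positive then `f < 0`.
  let k : H1 d := ⟨_, f.2.abs⟩ - f
  have hk : ∀ w, energyForm hv k w = lam * massForm d k w := fun w => by
    simp only [k, map_sub, LinearMap.sub_apply, habs, hf]; ring
  have hkx : ∀ x, k.1 x = |f.1 x| - f.1 x := fun x => rfl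
  rcases ae_eq_zero_or_ae_pos hvb (u := k)
    (fun x => by rw [hkx]; exact sub_nonneg.2 (le_abs_self _)) hk with h | h
  · rcases ae_eq_zero_or_ae_pos hvb (u := ⟨_, f.2.abs⟩) (fun x => abs_nonneg _) habs with h' | h'
    · left
      filter_upwards [h'] with x hx using abs_eq_zero.1 hx
    · right; left
      filter_upwards [h, h'] with x hx hx'
      rw [hkx, sub_eq_zero] at hx
      rwa [← hx]
  · right; right
    filter_upwards [h] with x hx
    rw [hkx] at hx
    by_contra h1
    rw [abs_of_nonneg (not_lt.1 h1)] at hx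
    simp at hx

/-- Otherwise `f² - g²` would be positive almost everywhere with integral zero. -/
theorem not_ae_lt_of_massForm_eq {f g : H1 d} (hg : ∀ᵐ x, 0 < g.1 x)
    (he : massForm d f f = massForm d g g) : ¬ ∀ᵐ x, g.1 x < f.1 x := by
  intro h
  rw [massForm_self, massForm_self] at he
  have hlt : ∀ᵐ x, 0 < f.1 x ^ 2 - g.1 x ^ 2 := by
    filter_upwards [hg, h] with x h1 h2
    nlinarith
  have hi := f.2.1.integrable_sq.sub g.2.1.integrable_sq
  have h0 : ∫ x, (f.1 x ^ 2 - g.1 x ^ 2) = 0 := by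
    rw [integral_sub f.2.1.integrable_sq g.2.1.integrable_sq, he, sub_self]
  have := (integral_eq_zero_iff_of_nonneg_ae (hlt.mono fun x hx => hx.le) hi).1 h0
  obtain ⟨x, h1, h2⟩ := (this.and hlt).exists
  exact h2.ne' h1

/-- Positive normalized ground states are unique. -/
theorem ae_eq_of_ae_pos {hv : MemY v} (hvb : MemLp v ⊤ volume) {lam : ℝ}
    (hlam : ∀ f : H1 d, lam * massForm d f f ≤ energyForm hv f f) {f g : H1 d}
    (hf : ∀ w, energyForm hv f w = lam * massForm d f w)
    (hg : ∀ w, energyForm hv g w = lam * massForm d g w)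
    (hfpos : ∀ᵐ x, 0 < f.1 x) (hgpos : ∀ᵐ x, 0 < g.1 x)
    (he : massForm d f f = massForm d g g) : f.1 =ᵐ[volume] g.1 := by
  -- By linearity the difference is again an eigenfunction at the bottom, so the trichotomy of signs
  -- applies to it.
  have hh : ∀ w, energyForm hv (f - g) w = lam * massForm d (f - g) w := fun w => by
    simp only [map_sub, LinearMap.sub_apply, hf, hg]; ring
  have hx : ∀ x, (f - g).1 x = f.1 x - g.1 x := fun x => rfl
  rcases ae_zero_or_pos_or_neg hvb hlam hh with h | h | h
  · filter_upwards [h] with x h1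
    rwa [hx, sub_eq_zero] at h1
  · refine absurd ?_ (not_ae_lt_of_massForm_eq hgpos he)
    filter_upwards [h] with x h1
    rwa [hx, sub_pos] at h1
  · refine absurd ?_ (not_ae_lt_of_massForm_eq hfpos he.symm)
    filter_upwards [h] with x h1
    rwa [hx, sub_neg] at h1

theorem IsEnergyMinimizer.congr_ae {f g : Space d → ℝ} (hf : IsEnergyMinimizer v f)
    (e : f =ᵐ[volume] g) : IsEnergyMinimizer v g := by
  have hE : energy v g = energy v f := by
    have h1 : ∫ x, ‖weakGradient g x‖ ^ 2 = ∫ x, ‖weakGradient f x‖ ^ 2 :=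
      integral_congr_ae ((hf.1.1.weakGradient_congr_ae e).mono fun x hx => by simp only [hx])
    have h2 : ∫ x, v x * g x ^ 2 = ∫ x, v x * f x ^ 2 :=
      integral_congr_ae (e.mono fun x hx => by simp only [hx])
    rw [energy, energy, h1, h2]
  refine ⟨⟨hf.1.1.congr_ae e, ?_⟩, fun k hk hk1 => hE ▸ hf.2 k hk hk1⟩
  rw [← hf.1.2]
  refine integral_congr_ae ?_
  filter_upwards [e] with x hx
  rw [hx]

/-- For bounded potentials, energy minimizers have a strict sign. -/
theorem IsEnergyMinimizer.ae_pos_or_ae_neg {N : ℕ} (hN : 1 ≤ N) (hvW : v ∈ W d N)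
    (hvb : MemLp v ⊤ volume) {f : Space d → ℝ} (hf : IsEnergyMinimizer v f) :
    (∀ᵐ x, 0 < f x) ∨ ∀ᵐ x, f x < 0 := by
  obtain ⟨lam, hlam, hE, -⟩ := exists_groundEnergy hN hvW hvW.1
  have h1 : massForm d ⟨f, hf.1.1⟩ ⟨f, hf.1.1⟩ = 1 := (massForm_self _).trans hf.1.2
  have hfe := energyForm_apply_eq hlam (f := ⟨f, hf.1.1⟩)
    (by rw [energyForm_self, h1, mul_one]; exact (hE f hf).le)
  refine (ae_zero_or_pos_or_neg hvb hlam hfe).resolve_left fun h => ?_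
  have hz : (fun x => f x ^ 2) =ᵐ[volume] 0 := h.mono fun x hx => by
    change f x = 0 at hx
    simp [hx]
  have : ∫ x, f x ^ 2 = 0 := integral_eq_zero_of_ae hz
  exact one_ne_zero (hf.1.2.symm.trans this)

/-- The moduli are positive normalized ground states and hence coincide; as `f` and `g` each have a
constant sign, only the two relative signs remain. -/
theorem IsEnergyMinimizer.ae_eq_or_ae_eq_neg {N : ℕ} (hN : 1 ≤ N) (hvW : v ∈ W d N)
    (hvb : MemLp v ⊤ volume) {f g : Space d → ℝ} (hf : IsEnergyMinimizer v f)
    (hg : IsEnergyMinimizer v g) : f =ᵐ[volume] g ∨ f =ᵐ[volume] -g := by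
  obtain ⟨lam, hlam, hE, -⟩ := exists_groundEnergy hN hvW hvW.1
  have h1 : ∀ {k : Space d → ℝ} (hk : IsEnergyMinimizer v k),
      massForm d ⟨k, hk.1.1⟩ ⟨k, hk.1.1⟩ = 1 := fun hk => (massForm_self _).trans hk.1.2
  have he : ∀ {k : Space d → ℝ} (hk : IsEnergyMinimizer v k) (w : H1 d),
      energyForm hvW.1 ⟨k, hk.1.1⟩ w = lam * massForm d ⟨k, hk.1.1⟩ w := fun hk =>
    energyForm_apply_eq hlam (by rw [energyForm_self, h1 hk, mul_one]; exact (hE _ hk).le)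
  have hfa := (hf.abs hN hvW).1
  have hga := (hg.abs hN hvW).1
  have hpos : ∀ {k : Space d → ℝ}, IsEnergyMinimizer v k → ∀ᵐ x, 0 < |k x| := fun hk => by
    rcases hk.ae_pos_or_ae_neg hN hvW hvb with h | h
    · exact h.mono fun x hx => abs_pos.2 hx.ne'
    · exact h.mono fun x hx => abs_pos.2 hx.ne
  have hab : ∀ᵐ x, |f x| = |g x| := ae_eq_of_ae_pos hvb hlam (he hfa) (he hga) (hpos hf) (hpos hg)
    ((h1 hfa).trans (h1 hga).symm)
  rcases hf.ae_pos_or_ae_neg hN hvW hvb with h | h <;> rcases hg.ae_pos_or_ae_neg hN hvW hvb with h' | h'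
  · left
    filter_upwards [hab, h, h'] with x e p q
    rwa [abs_of_pos p, abs_of_pos q] at e
  · right
    filter_upwards [hab, h, h'] with x e p q
    rwa [abs_of_pos p, abs_of_neg q] at e
  · right
    filter_upwards [hab, h, h'] with x e p q
    rw [abs_of_neg p, abs_of_pos q] at e
    rw [Pi.neg_apply, ← e, neg_neg]
  · left
    filter_upwards [hab, h, h'] with x e p q
    rwa [abs_of_neg p, abs_of_neg q, neg_inj] at e

/-- For bounded potentials there is a lowest orbital that is positive everywhere. -/
theorem exists_pos_isLowestOrbital {N : ℕ} (hN : 1 ≤ N) (hvW : v ∈ W d N)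
    (hvb : MemLp v ⊤ volume) : ∃ f, IsLowestOrbital N v f ∧ ∀ x, 0 < f x := by
  obtain ⟨f₀, hf₀⟩ := exists_isLowestOrbital hN hvW
  have hmin := hf₀.isEnergyMinimizer hvW.1
  classical
  -- The value `1` on the null set of zeros gives positivity at every point.
  let f : Space d → ℝ := fun x => if f₀ x = 0 then 1 else |f₀ x|
  have hf : ∀ x, 0 < f x := fun x => by
    by_cases h : f₀ x = 0
    · simp [f, h]
    · simp [f, h]
  have e : (fun x => |f₀ x|) =ᵐ[volume] f := by
    rcases hmin.ae_pos_or_ae_neg hN hvW hvb with h | h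
    · filter_upwards [h] with x hx
      simp [f, hx.ne']
    · filter_upwards [h] with x hx
      simp [f, hx.ne]
  -- The change on a null set is made among energy minimizers; taking the modulus once more returns
  -- a lowest orbital, and it leaves the positive `f` unchanged.
  have := (((hmin.abs hN hvW).1.congr_ae e).abs hN hvW).2
  have e' : (fun x => |f x|) = f := funext fun x => abs_of_pos (hf x)
  rw [e'] at this
  exact ⟨f, this, hf⟩

end RKS

end

theorem mainTheorem4 (d N : ℕ) (hd : 1 ≤ d) (hN : 1 ≤ N)
    (v : RKS.Space d → ℝ) (hv : v ∈ RKS.W d N) :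
    (∃ f, RKS.IsLowestOrbital N v f) ∧
    (∀ f, RKS.IsLowestOrbital N v f → RKS.IsEnergyMinimizer v f) ∧
    (∀ f, RKS.IsEnergyMinimizer v f →
      RKS.IsEnergyMinimizer v (fun x => |f x|) ∧ RKS.IsLowestOrbital N v (fun x => |f x|)) ∧
    (MemLp v ∞ volume →
      (∀ f g, RKS.IsLowestOrbital N v f → RKS.IsLowestOrbital N v g →
        f =ᵐ[volume] g ∨ f =ᵐ[volume] -g) ∧
      ∃ f, RKS.IsLowestOrbital N v f ∧ ∀ x, 0 < f x) := by
  refine ⟨RKS.exists_isLowestOrbital hN hv, fun f hf => hf.isEnergyMinimizer hv.1,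
    fun f hf => hf.abs hN hv, fun hvb => ⟨fun f g hf hg => ?_,
      RKS.exists_pos_isLowestOrbital hN hv hvb⟩⟩
  exact (hf.isEnergyMinimizer hv.1).ae_eq_or_ae_eq_neg hN hv hvb (hg.isEnergyMinimizer hv.1)
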